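/- **Setting.** Let $M,K,N_c,R,s$ be natural numbers with $M,K\ge 1$ and $1\le R\le N_c$. There are $KN_c$ users $(c,k)$, $1\le c\le N_c$, $1\le k\le K$, and $M$ radio heads. The channel from user $(c,k)$ to head $i$ is $H^{[c]}_{ik}=g^{[c]}_{ik}h^{[c]}_{ik}$, where the $h^{[c]}_{ik}$ are i.i.d. $\mathcal{CN}(0,1)$, and the $g^{[c]}_{ik}\ge 0$ satisfy $\mathbb E|g^{[c]}_{ik}|^2=1$ and $\sum_{i}(g^{[c]}_{ik})^2=M$, with the vectors $(g^{[c]}_{ik})_i$ independent for different users. $\mathbf H_i\in\mathbb C^{N_c\times KN_c}$ has entry $H^{[c]}_{ik}$ in row $c$ and column $(c,k)$, and zeros elsewhere. $\mathbf A_i\in\mathbb C^{R\times N_c}$ has entries $(MR)^{-1/2}e^{\mathrm j\theta_{irc}}$ with $\theta_{irc}$ i.i.d. uniform on $[0,2\pi)$. A set $\mathcal T$ of $s$ users is active: $x_l\sim\mathcal{CN}(0,P)$ for $l\in\mathcal T$ and $x_l=0$ otherwise. The noise vectors $\mathbf n_i\in\mathbb C^{N_c}$ have i.i.d. $\mathcal{CN}(0,1)$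 entries. The families $(g),(h),(\theta),(x),(\mathbf n_i)$ are mutually independent. Let $\Theta$ be the $MR\times KN_c$ matrix obtained by stacking the $\mathbf A_i\mathbf H_i$, let $\mathbf z$ be the vector obtained by stacking $\mathbf A_i(\mathbf H_i\mathbf x+\mathbf n_i)$, let $\mathbf A=\mathrm{diag}(\mathbf A_1,\dots,\mathbf A_M)$ and let $\alpha=R/N_c$. For a matrix $\mathbf B$, $\mathbf B^\dagger$ is its Moore–Penrose pseudoinverse, and $\Theta_{\mathcal S}$ is the submatrix of the columns of $\Theta$ in $\mathcal S$. **Detection with threshold $\lambda$.** Let $\hat{\mathbf x}$ minimize $\|\mathbf v\|_1$ subject to $\|\Theta\mathbf v-\mathbf z\|\le\lambda$ (any vector, if this is infeasible). Sort the users by decreasing $|\hat x_l|$ and let $\hat{\mathcal T}$ consist of the first $k$ of them, where $k\ge1$ is the smallest number for which $\|(\mathbf I-\Theta_{\hat{\mathcal T}}\Theta_{\hat{\mathcal T}}^\dagger)\mathbf z\|\le\lambda$ or $k=MR$ (and $k=KN_c$ if there is no such $k\le KN_c$). Minimizers and ties may be chosen arbitrarily, as long as $\hat{\mathcal T}$ is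 measurable. **Rate.** Let $\Psi=\Theta_{\hat{\mathcal T}}^\dagger\big(P\,\Theta_{\mathcal T\setminus\hat{\mathcal T}}\Theta_{\mathcal T\setminus\hat{\mathcal T}}^H+\mathbf A\mathbf A^H\big)(\Theta_{\hat{\mathcal T}}^\dagger)^H$ with diagonal entries $\alpha_l$, $l\in\hat{\mathcal T}$. The zero-forcing sum rate is $R_{sum}=\sum_{l\in\hat{\mathcal T}}\log(1+P_l/\alpha_l)$, where $P_l=P$ if $l\in\mathcal T$ and $P_l=0$ otherwise, and $R_{sum}=0$ if $\Theta_{\hat{\mathcal T}}^H\Theta_{\hat{\mathcal T}}$ is singular (then there is no zero-forcing receiver). For $0\le\delta<1$, $\mathcal E_{k,\delta}$ is the event that $(1-\delta)\|\mathbf v\|^2\le\|\Theta\mathbf v\|^2\le(1+\delta)\|\mathbf v\|^2$ for all $\mathbf v\in\mathbb C^{KN_c}$ with at most $k$ nonzero entries. **Theorem.** 1. (Upper bound) For every $P>0$ and every $\lambda$, $R_{sum}$ is integrable and $\mathbb E(R_{sum})\le s\log(1+M\alpha P)$. 2. (Lower bound at high SNR) Let $0\le\delta<\sqrt2-1$ and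 $c_2=\frac{4\sqrt{1+\delta}}{1-(1+\sqrt2)\delta}$. There is a constant $\kappa>0$, which depends only on $M,K,N_c,R,s,\delta$, such that whenever $P\ge\kappa\cdot4c_2^2N_c$ and $\lambda=\big(\tfrac{PN_c}{4c_2^2}\big)^{1/4}$, $$\mathbb E(R_{sum})\ \ge\ \Pr(\mathcal E_{2s,\delta})\cdot s\log\big(1+(1-\delta)M\alpha P\big).$$ -/

import Mathlib

open MeasureTheory ProbabilityTheory
open scoped Matrix

namespace CRAN

noncomputable section

/-! ## Linear algebra -/

/-- The Moore-Penrose pseudoinverse `B† = (Bᴴ B)⁺ Bᴴ`. Here `G⁺` is the Hermitian matrix `G` with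
every eigenvalue `t` replaced by `t⁻¹`, where `0⁻¹ = 0`; it is `G⁻¹` for invertible `G`. -/
def pinv {m n : Type*} [Fintype m] [Fintype n] [DecidableEq n] (B : Matrix m n ℂ) :
    Matrix n m ℂ :=
  (Matrix.isHermitian_conjTranspose_mul_self B).cfc (fun t : ℝ => t⁻¹) * Bᴴ

open scoped ComplexOrder in
/-- `pinv B` satisfies the four Penrose equations, and it is `(Bᴴ B)⁻¹ Bᴴ` if `Bᴴ B` is
invertible. -/
theorem pinv_spec {m n : Type*} [Fintype m] [Fintype n] [DecidableEq n] (B : Matrix m n ℂ) :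
    B * pinv B * B = B ∧ pinv B * B * pinv B = pinv B ∧
      (B * pinv B)ᴴ = B * pinv B ∧ (pinv B * B)ᴴ = pinv B * B ∧
      (IsUnit (Bᴴ * B) → pinv B = (Bᴴ * B)⁻¹ * Bᴴ) := by
  have hG := Matrix.isHermitian_conjTranspose_mul_self B
  have hp : pinv B = cfc (fun t : ℝ => t⁻¹) (Bᴴ * B) * Bᴴ := by rw [pinv, hG.cfc_eq]
  set G := Bᴴ * B with hGdef
  have hsa : IsSelfAdjoint G := hG
  have hc : ∀ f : ℝ → ℝ, ContinuousOn f (spectrum ℝ G) := fun f =>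
    (Matrix.finite_real_spectrum (A := G)).continuousOn f
  have hid : cfc (fun t : ℝ => t) G = G := cfc_id' ℝ G
  set X := cfc (fun t : ℝ => t⁻¹) G with hX
  have hXh : Xᴴ = X := (cfc_predicate (R := ℝ) (fun t : ℝ => t⁻¹) G : IsSelfAdjoint _)
  have hXG : X * G = cfc (fun t : ℝ => t⁻¹ * t) G := by
    rw [cfc_mul (fun t : ℝ => t⁻¹) (fun t => t) G (hc _) (hc _), hid]
  have hGX : G * X = cfc (fun t : ℝ => t⁻¹ * t) G := by
    rw [show (fun t : ℝ => t⁻¹ * t) = fun t => t * t⁻¹ from funext fun t => mul_comm _ _,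
      cfc_mul (fun t : ℝ => t) (fun t => t⁻¹) G (hc _) (hc _), hid]
  have hGXG : G * X * G = G := by
    conv_rhs => rw [← hid]
    rw [hGX]; nth_rewrite 2 [← hid]
    rw [← cfc_mul _ _ G (hc _) (hc _)]
    congr 1; funext t; by_cases h : t = 0 <;> simp [h]
  have hXGX : X * G * X = X := by
    rw [hXG, hX, ← cfc_mul _ _ G (hc _) (hc _)]
    congr 1; funext t; by_cases h : t = 0 <;> simp [h]
  have hB : B * (X * G) = B := by
    have h0 : (B * (X * G - 1))ᴴ * (B * (X * G - 1)) = 0 := by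
      have h1 : (B * (X * G - 1))ᴴ * (B * (X * G - 1)) = (X * G - 1)ᴴ * (G * X * G - G) := by
        rw [Matrix.conjTranspose_mul, Matrix.mul_assoc, ← Matrix.mul_assoc Bᴴ, ← hGdef, mul_sub,
          mul_one, mul_assoc]
      rw [h1, hGXG]; simp
    have h2 := Matrix.conjTranspose_mul_self_eq_zero.1 h0
    rw [Matrix.mul_sub, Matrix.mul_one, sub_eq_zero] at h2
    exact h2
  rw [hp]
  refine ⟨?_, ?_, ?_, ?_, ?_⟩
  · rw [Matrix.mul_assoc, Matrix.mul_assoc, ← hGdef, hB]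
  · rw [Matrix.mul_assoc X, ← hGdef, ← Matrix.mul_assoc, hXGX]
  · simp [Matrix.conjTranspose_mul, hXh, Matrix.mul_assoc]
  · rw [Matrix.mul_assoc, ← hGdef, Matrix.conjTranspose_mul, hXh, hG.eq, hGX, hXG]
  · intro hU
    have h3 : X * G = 1 := by
      have h4 : G * (X * G) = G * 1 := by rw [← mul_assoc, hGXG, mul_one]
      exact hU.mul_left_cancel h4
    rw [Matrix.inv_eq_left_inv h3]

/-- The submatrix of the columns with index in `S`. -/
def cols {m ι : Type*} (B : Matrix m ι ℂ) (S : Finset ι) : Matrix m S ℂ :=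
  B.submatrix id (fun l : S => (l : ι))

/-- Euclidean norm of a complex vector. -/
def euclNorm {m : Type*} [Fintype m] (v : m → ℂ) : ℝ := ‖WithLp.toLp 2 v‖

/-- `B` satisfies the restricted isometry property of order `k` with constant `δ`. -/
def RIP {m ι : Type*} [Fintype m] [Fintype ι] (B : Matrix m ι ℂ) (k : ℕ) (δ : ℝ) : Prop :=
  0 ≤ δ ∧ δ < 1 ∧ ∀ v : ι → ℂ, (Finset.univ.filter fun l => v l ≠ 0).card ≤ k →
    (1 - δ) * euclNorm v ^ 2 ≤ euclNorm (B *ᵥ v) ^ 2 ∧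
      euclNorm (B *ᵥ v) ^ 2 ≤ (1 + δ) * euclNorm v ^ 2

/-! ## The random model -/

/-- The law `𝒞𝒩(0, v)`: independent real and imaginary parts with law `𝒩(0, v / 2)`. -/
def complexGaussian (v : ℝ) : Measure ℂ :=
  ((gaussianReal 0 (v / 2).toNNReal).prod (gaussianReal 0 (v / 2).toNNReal)).map
    (fun p : ℝ × ℝ => (p.1 : ℂ) + (p.2 : ℂ) * Complex.I)

/-- The users: `(c, k)` is the `k`-th user on the `c`-th subcarrier. -/
abbrev UE (K Nc : ℕ) : Type := Fin Nc × Fin K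

/-- The random quantities of the uplink system with `M` radio heads, `Nc` subcarriers, `K` users on
each subcarrier, compressed dimension `R`, active users `T` and transmit SNR `P`. -/
structure Model {Ω : Type*} [MeasurableSpace Ω] (μ : Measure Ω) (M K Nc R : ℕ)
    (T : Finset (UE K Nc)) (P : ℝ) where
  /-- large scale fading from a user to a radio head -/
  g : Fin M → UE K Nc → Ω → ℝ
  /-- small scale fading from a user to a radio head -/
  h : Fin M → UE K Nc → Ω → ℂ
  /-- phases of the entries of the compression matrices -/
  θ : Fin M → Fin R → Fin Nc → Ω → ℝ
  /-- transmitted symbols -/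
  x : UE K Nc → Ω → ℂ
  /-- receiver noise at the radio heads -/
  n : Fin M → Fin Nc → Ω → ℂ
  measurable_g : ∀ i l, Measurable (g i l)
  measurable_h : ∀ i l, Measurable (h i l)
  measurable_θ : ∀ i r c, Measurable (θ i r c)
  measurable_x : ∀ l, Measurable (x l)
  measurable_n : ∀ i c, Measurable (n i c)
  g_nonneg : ∀ i l, ∀ᵐ ω ∂μ, 0 ≤ g i l ω
  /-- normalization; in particular every `g i l` is bounded -/
  g_normalized : ∀ l, ∀ᵐ ω ∂μ, ∑ i, g i l ω ^ 2 = M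
  g_secondMoment : ∀ i l, ∫ ω, g i l ω ^ 2 ∂μ = 1
  g_indep : iIndepFun (fun l ω => fun i => g i l ω) μ
  h_law : ∀ i l, μ.map (h i l) = complexGaussian 1
  h_indep : iIndepFun (fun p : Fin M × UE K Nc => h p.1 p.2) μ
  θ_law : ∀ i r c, pdf.IsUniform (θ i r c) (Set.Ico 0 (2 * Real.pi)) μ
  θ_indep : iIndepFun (fun p : Fin M × Fin R × Fin Nc => θ p.1 p.2.1 p.2.2) μ
  x_active : ∀ l ∈ T, μ.map (x l) = complexGaussian P
  x_inactive : ∀ l ∉ T, ∀ᵐ ω ∂μ, x l ω = 0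
  n_law : ∀ i c, μ.map (n i c) = complexGaussian 1
  n_indep : iIndepFun (fun p : Fin M × Fin Nc => n p.1 p.2) μ
  /- The five families `g`, `h`, `θ`, `x`, `n` are mutually independent. -/
  indep_g : IndepFun (fun ω => fun i l => g i l ω)
    (fun ω => ((fun i l => h i l ω), (fun i r c => θ i r c ω), (fun l => x l ω),
      (fun i c => n i c ω))) μ
  indep_h : IndepFun (fun ω => fun i l => h i l ω)
    (fun ω => ((fun i r c => θ i r c ω), (fun l => x l ω), (fun i c => n i c ω))) μ
  indep_θ : IndepFun (fun ω => fun i r c => θ i r c ω)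
    (fun ω => ((fun l => x l ω), (fun i c => n i c ω))) μ
  indep_x : IndepFun (fun ω => fun l => x l ω) (fun ω => fun i c => n i c ω) μ

namespace Model

variable {Ω : Type*} [MeasurableSpace Ω] {μ : Measure Ω} {M K Nc R : ℕ}
  {T : Finset (UE K Nc)} {P : ℝ}

/-- The `Nc × K Nc` channel matrix `𝐇ᵢ` to the `i`-th radio head, with entries `g h`. -/
def channel (S : Model μ M K Nc R T P) (ω : Ω) (i : Fin M) : Matrix (Fin Nc) (UE K Nc) ℂ :=
  Matrix.of fun c l => if c = l.1 then (S.g i l ω : ℂ) * S.h i l ω else 0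

/-- The `R × Nc` compression matrix `𝐀ᵢ` of the `i`-th radio head. -/
def compression (S : Model μ M K Nc R T P) (ω : Ω) (i : Fin M) : Matrix (Fin R) (Fin Nc) ℂ :=
  Matrix.of fun r c =>
    (Real.sqrt (1 / (M * R)) : ℂ) * Complex.exp (Complex.I * (S.θ i r c ω : ℂ))

/-- `𝐀 = diag(𝐀₁, …, 𝐀_M)`; the pair `(r, i)` is the `r`-th row of the `i`-th block. -/
def compressionDiag (S : Model μ M K Nc R T P) (ω : Ω) :
    Matrix (Fin R × Fin M) (Fin Nc × Fin M) ℂ :=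
  Matrix.blockDiagonal (S.compression ω)

/-- The aggregate measurement matrix `Θ`: the matrices `𝐀ᵢ 𝐇ᵢ` stacked. -/
def measMatrix (S : Model μ M K Nc R T P) (ω : Ω) : Matrix (Fin R × Fin M) (UE K Nc) ℂ :=
  Matrix.of fun p l => (S.compression ω p.2 * S.channel ω p.2) p.1 l

/-- The received symbols `𝐲ᵢ = 𝐇ᵢ 𝐱 + 𝐧ᵢ` at the `i`-th radio head. -/
def received (S : Model μ M K Nc R T P) (ω : Ω) (i : Fin M) : Fin Nc → ℂ :=
  S.channel ω i *ᵥ (fun l => S.x l ω) + fun c => S.n i c ω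

/-- The compressed observations `𝐳ᵢ = 𝐀ᵢ 𝐲ᵢ`, stacked. -/
def observed (S : Model μ M K Nc R T P) (ω : Ω) : Fin R × Fin M → ℂ :=
  fun p => (S.compression ω p.2 *ᵥ S.received ω p.2) p.1

end Model

/-! ## The recovery algorithm -/

/-- `xhat` is a possible result of basis pursuit with threshold `lam`: a minimizer of the
`ℓ¹`-norm under the constraint `‖Θ v - z‖ ≤ lam`. Nothing is required of `xhat` if no vector is
feasible. -/
def IsBasisPursuit {m ι : Type*} [Fintype m] [Fintype ι] (Θ : Matrix m ι ℂ) (z : m → ℂ)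
    (lam : ℝ) (xhat : ι → ℂ) : Prop :=
  (∃ v : ι → ℂ, euclNorm (Θ *ᵥ v - z) ≤ lam) →
    euclNorm (Θ *ᵥ xhat - z) ≤ lam ∧
      ∀ v : ι → ℂ, euclNorm (Θ *ᵥ v - z) ≤ lam → ∑ l, ‖xhat l‖ ≤ ∑ l, ‖v l‖

/-- The residual `‖(I - Θ_S Θ_S†) z‖`. -/
def residual {m ι : Type*} [Fintype m] [DecidableEq m] [DecidableEq ι] (Θ : Matrix m ι ℂ)
    (z : m → ℂ) (S : Finset ι) : ℝ :=
  euclNorm ((1 - cols Θ S * pinv (cols Θ S)) *ᵥ z)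

/-- The first `k` users in the order `σ`. -/
def firstUsers {K Nc : ℕ} (σ : Fin (Nc * K) ≃ UE K Nc) (k : ℕ) : Finset (UE K Nc) :=
  (Finset.univ.filter fun j : Fin (Nc * K) => (j : ℕ) < k).image σ

/-- `That` is a possible result of greedy active user detection from `xhat`: sort the users by
decreasing `|xhat|`, and take users in this order, at least one, until the residual is at most
`lam` or `M R` users are taken (or no user is left). -/
def IsGreedyDetection {M K Nc R : ℕ} (Θ : Matrix (Fin R × Fin M) (UE K Nc) ℂ)
    (z : Fin R × Fin M → ℂ) (lam : ℝ) (xhat : UE K Nc → ℂ) (That : Finset (UE K Nc)) : Prop :=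
  ∃ σ : Fin (Nc * K) ≃ UE K Nc, (Antitone fun j => ‖xhat (σ j)‖) ∧
    ∃ k : ℕ, 1 ≤ k ∧ k ≤ Nc * K ∧ That = firstUsers σ k ∧
      (residual Θ z (firstUsers σ k) ≤ lam ∨ k = M * R ∨ k = Nc * K) ∧
      ∀ j : ℕ, 1 ≤ j → j < k → ¬ (residual Θ z (firstUsers σ j) ≤ lam ∨ j = M * R)

/-- `That` is a possible set of detected users: basis pursuit followed by greedy detection. -/
def IsDetected {M K Nc R : ℕ} (Θ : Matrix (Fin R × Fin M) (UE K Nc) ℂ)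
    (z : Fin R × Fin M → ℂ) (lam : ℝ) (That : Finset (UE K Nc)) : Prop :=
  ∃ xhat : UE K Nc → ℂ, IsBasisPursuit Θ z lam xhat ∧ IsGreedyDetection Θ z lam xhat That

/-! ## The sum rate of the zero-forcing receiver -/

/-- Interference plus noise covariance
`Ψ = Θ_That† (P Θ_{T \ That} Θ_{T \ That}ᴴ + A Aᴴ) (Θ_That†)ᴴ`. -/
def covariance {m q ι : Type*} [Fintype m] [Fintype q] [DecidableEq ι]
    (Θ : Matrix m ι ℂ) (A : Matrix m q ℂ) (P : ℝ) (T That : Finset ι) :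
    Matrix That That ℂ :=
  pinv (cols Θ That) *
      ((P : ℂ) • (cols Θ (T \ That) * (cols Θ (T \ That))ᴴ) + A * Aᴴ) *
    (pinv (cols Θ That))ᴴ

open Classical in
/-- Sum rate of zero forcing on the detected set `That` when `T` is active. It is `0` if the Gram
matrix of the detected columns is singular, when there is no zero-forcing receiver. -/
def sumRate {m q ι : Type*} [Fintype m] [Fintype q] [DecidableEq ι]
    (Θ : Matrix m ι ℂ) (A : Matrix m q ℂ) (P : ℝ) (T That : Finset ι) : ℝ :=
  if IsUnit ((cols Θ That)ᴴ * cols Θ That) then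
    ∑ l : That, Real.log (1 + (if (l : ι) ∈ T then P else 0) / (covariance Θ A P T That l l).re)
  else 0

/-- The constant `c₂ = 4 √(1 + δ) / (1 - (1 + √2) δ)`. -/
def c₂ (δ : ℝ) : ℝ := 4 * Real.sqrt (1 + δ) / (1 - (1 + Real.sqrt 2) * δ)

end

end CRAN

namespace CRAN

/-! ## The Euclidean norm -/

section Norm

variable {m ι : Type*} [Fintype m] [Fintype ι]

/-! Upper bound. A zero-forcing row `w` has unit gain towards its own user. Expanding this gain over
the radio heads and applying Cauchy–Schwarz bounds the noise power `‖wA‖²` below by the reciprocal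
of `capturedPower`, a sum of `g²|h|²` weighted by the leverage scores of the user's subcarrier
(`Model.one_le_capturedPower_mul`). This holds pathwise for every detected set, so the dependence of
detection on the channel is harmless. The leverage scores of an `R`-row matrix sum to at most `R`
and are exchangeable because the phases are i.i.d., so each has mean at most `R / Nc`. Concavity of
the logarithm finishes the argument.

Lower bound. If `Θ`, or a rescaled copy `Θ / t`, has the restricted isometry property, the noise is
at most of order `λ` and every active symbol exceeds a fixed multiple of `λ`, then basis pursuit and
greedy selection return exactly `T` (`IsDetected.eq_of_rip`). Since `λ` grows like `P^(1/4)`, these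
noise and symbol conditions hold with probability tending to 1. On `That = T` there is no
interference, and crude norm bounds give a rate `s log(1 + P / C₀)`.

The constant `C₀` is worse than the one claimed, and the probability of the noise and symbol
conditions is below 1. Both losses are paid by a second event: for small `t`, the isometry property
of `Θ / t` is incompatible with that of `Θ`, yet has at least a fixed fraction `c` of its
probability, because the Gaussian density controls its own rescaling
(`Model.mul_measure_le_scaled`). Total success probability thus gains a factor `1 + c`. As both
rates are `s log P + O(1)`, this factor wins for large `P` (`eventually_log_le`). -/

theorem euclNorm_nonneg (v : m → ℂ) : 0 ≤ euclNorm v := norm_nonneg _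

theorem euclNorm_sq (v : m → ℂ) : euclNorm v ^ 2 = ∑ i, ‖v i‖ ^ 2 := by
  rw [euclNorm, EuclideanSpace.norm_sq_eq]

theorem euclNorm_sub_le (v w : m → ℂ) : euclNorm (v - w) ≤ euclNorm v + euclNorm w :=
  norm_sub_le (WithLp.toLp 2 v) (WithLp.toLp 2 w)

theorem euclNorm_smul (a : ℂ) (v : m → ℂ) : euclNorm (a • v) = ‖a‖ * euclNorm v :=
  norm_smul a (WithLp.toLp 2 v)

theorem euclNorm_neg (v : m → ℂ) : euclNorm (-v) = euclNorm v :=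
  norm_neg (WithLp.toLp 2 v)

theorem norm_le_euclNorm (v : m → ℂ) (i : m) : ‖v i‖ ≤ euclNorm v :=
  PiLp.norm_apply_le (WithLp.toLp 2 v) i

theorem euclNorm_eq_zero {v : m → ℂ} : euclNorm v = 0 ↔ v = 0 := by
  rw [euclNorm, norm_eq_zero]
  exact WithLp.toLp_eq_zero 2

/-- The Frobenius norm stands in for the operator norm. The loss is harmless: the lower bound needs
the rate only up to a constant inside the logarithm. -/
theorem euclNorm_mulVec_sq_le (B : Matrix m ι ℂ) (v : ι → ℂ) :
    euclNorm (B *ᵥ v) ^ 2 ≤ (∑ i, ∑ j, ‖B i j‖ ^ 2) * euclNorm v ^ 2 := by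
  rw [euclNorm_sq, euclNorm_sq, Finset.sum_mul]
  refine Finset.sum_le_sum fun i _ => ?_
  calc ‖(B *ᵥ v) i‖ ^ 2 ≤ (∑ j, ‖B i j‖ * ‖v j‖) ^ 2 := by
        gcongr
        refine (norm_sum_le _ _).trans_eq ?_
        simp
    _ ≤ _ := Finset.sum_mul_sq_le_sq_mul_sq _ _ _

theorem star_dotProduct_self_eq (v : m → ℂ) : star v ⬝ᵥ v = ((euclNorm v ^ 2 : ℝ) : ℂ) := by
  rw [euclNorm_sq, dotProduct]
  push_cast
  refine Finset.sum_congr rfl fun i _ => ?_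
  rw [Pi.star_apply, RCLike.star_def, RCLike.conj_mul]
  simp

end Norm

/-! ## Stability of basis pursuit -/

section Recovery

variable {m ι : Type*} [Fintype m] [Fintype ι]

/-- Real part of the inner product of two complex vectors. -/
noncomputable def reInner (v w : m → ℂ) : ℝ :=
  (inner ℂ (WithLp.toLp 2 v) (WithLp.toLp 2 w)).re

theorem reInner_add_right (u v w : m → ℂ) : reInner u (v + w) = reInner u v + reInner u w := by
  simp [reInner]

theorem reInner_add_left (u v w : m → ℂ) : reInner (u + v) w = reInner u w + reInner v w := by
  simp [reInner]

theorem reInner_self (u : m → ℂ) : reInner u u = euclNorm u ^ 2 := by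
  rw [reInner, euclNorm, ← inner_self_eq_norm_sq (𝕜 := ℂ)]; rfl

theorem abs_reInner_le (u v : m → ℂ) : |reInner u v| ≤ euclNorm u * euclNorm v :=
  (Complex.abs_re_le_norm _).trans (norm_inner_le_norm _ _)

theorem reInner_smul_smul (a b : ℝ) (u v : m → ℂ) :
    reInner ((a : ℂ) • u) ((b : ℂ) • v) = a * b * reInner u v := by
  simp only [reInner, WithLp.toLp_smul, inner_smul_left, inner_smul_right]
  simp
  ring

theorem euclNorm_add_sq (u v : m → ℂ) :
    euclNorm (u + v) ^ 2 = euclNorm u ^ 2 + 2 * reInner u v + euclNorm v ^ 2 :=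
  norm_add_sq (𝕜 := ℂ) (WithLp.toLp 2 u) (WithLp.toLp 2 v)

theorem euclNorm_sub_sq (u v : m → ℂ) :
    euclNorm (u - v) ^ 2 = euclNorm u ^ 2 - 2 * reInner u v + euclNorm v ^ 2 :=
  norm_sub_sq (𝕜 := ℂ) (WithLp.toLp 2 u) (WithLp.toLp 2 v)

theorem RIP.of_support [DecidableEq ι] {B : Matrix m ι ℂ} {k : ℕ} {δ : ℝ} (h : RIP B k δ)
    {v : ι → ℂ} {S : Finset ι} (hv : ∀ l ∉ S, v l = 0) (hS : S.card ≤ k) :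
    (1 - δ) * euclNorm v ^ 2 ≤ euclNorm (B *ᵥ v) ^ 2 ∧
      euclNorm (B *ᵥ v) ^ 2 ≤ (1 + δ) * euclNorm v ^ 2 := by
  refine h.2.2 v ((Finset.card_le_card fun l hl => ?_).trans hS)
  by_contra hc
  exact (Finset.mem_filter.1 hl).2 (hv l hc)

/-- Vectors with disjoint supports have almost orthogonal images. -/
theorem RIP.abs_reInner_le [DecidableEq ι] {B : Matrix m ι ℂ} {k : ℕ} {δ : ℝ} (h : RIP B k δ)
    {u v : ι → ℂ} {S S' : Finset ι} (hu : ∀ l ∉ S, u l = 0) (hv : ∀ l ∉ S', v l = 0)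
    (hd : Disjoint S S') (hS : S.card + S'.card ≤ k) :
    |reInner (B *ᵥ u) (B *ᵥ v)| ≤ δ * euclNorm u * euclNorm v := by
  set a := euclNorm u with ha
  set b := euclNorm v with hb
  have ha0 : 0 ≤ a := euclNorm_nonneg _
  have hb0 : 0 ≤ b := euclNorm_nonneg _
  have huv : reInner u v = 0 := by
    rw [reInner, EuclideanSpace.inner_eq_star_dotProduct, dotProduct]
    rw [Finset.sum_eq_zero, Complex.zero_re]
    intro l _
    by_cases hl : l ∈ S
    · simp [hv l (Finset.disjoint_left.1 hd hl)]
    · simp [hu l hl]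
  rcases eq_or_lt_of_le ha0 with ha1 | ha1
  · have : u = 0 := euclNorm_eq_zero.1 ha1.symm
    simp [← ha1, this, reInner]
  rcases eq_or_lt_of_le hb0 with hb1 | hb1
  · have : v = 0 := euclNorm_eq_zero.1 hb1.symm
    simp [← hb1, this, reInner]
  -- Scaling each vector by the norm of the other makes both norms `a * b`. Polarization of `‖B(u' ±
  -- v')‖²` then leaves only the `δ` terms.
  set u' : ι → ℂ := (b : ℂ) • u
  set v' : ι → ℂ := (a : ℂ) • v
  have hsupp : ∀ l ∉ S ∪ S', (u' + v') l = 0 ∧ (u' - v') l = 0 := by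
    intro l hl
    rw [Finset.mem_union, not_or] at hl
    simp [u', v', hu l hl.1, hv l hl.2]
  have hcard : (S ∪ S').card ≤ k := (Finset.card_union_le _ _).trans hS
  have h1 := h.of_support (fun l hl => (hsupp l hl).1) hcard
  have h2 := h.of_support (fun l hl => (hsupp l hl).2) hcard
  have hn : reInner u' v' = 0 := by rw [reInner_smul_smul, huv, mul_zero]
  have hu' : euclNorm u' ^ 2 = (a * b) ^ 2 := by
    rw [euclNorm_smul, Complex.norm_real, Real.norm_of_nonneg hb0]; ring
  have hv' : euclNorm v' ^ 2 = (a * b) ^ 2 := by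
    rw [euclNorm_smul, Complex.norm_real, Real.norm_of_nonneg ha0]
  rw [Matrix.mulVec_add, euclNorm_add_sq, euclNorm_add_sq, hn, hu', hv'] at h1
  rw [Matrix.mulVec_sub, euclNorm_sub_sq, euclNorm_sub_sq, hn, hu', hv'] at h2
  have hB : reInner (B *ᵥ u') (B *ᵥ v') = b * a * reInner (B *ᵥ u) (B *ᵥ v) := by
    rw [Matrix.mulVec_smul, Matrix.mulVec_smul, reInner_smul_smul]
  rw [hB] at h1 h2
  have hab : 0 < a * b := mul_pos ha1 hb1
  rw [abs_le]
  constructor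
  · refine le_of_mul_le_mul_left ?_ hab
    nlinarith [h1.1, h1.2, h2.1, h2.2]
  · refine le_of_mul_le_mul_left ?_ hab
    nlinarith [h1.1, h1.2, h2.1, h2.2]

/-- Restriction of a vector to a set of indices. -/
def restrict {ι : Type*} [DecidableEq ι] (v : ι → ℂ) (S : Finset ι) : ι → ℂ := fun l => if l ∈ S then v l else 0

/-! ### Restriction of vectors to index sets. -/

section Restrict

variable [DecidableEq ι]

theorem restrict_of_notMem {ι : Type*} [DecidableEq ι] (v : ι → ℂ) (S : Finset ι) {l : ι} (hl : l ∉ S) : restrict v S l = 0 :=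
  if_neg hl

theorem euclNorm_restrict_sq (v : ι → ℂ) (S : Finset ι) :
    euclNorm (restrict v S) ^ 2 = ∑ l ∈ S, ‖v l‖ ^ 2 := by
  rw [euclNorm_sq, ← Finset.sum_filter_add_sum_filter_not Finset.univ (· ∈ S)]
  rw [Finset.filter_mem_eq_inter, Finset.univ_inter, Finset.sum_eq_zero (s := Finset.filter _ _),
    add_zero]
  · exact Finset.sum_congr rfl fun l hl => by simp [restrict, hl]
  · intro l hl
    simp [restrict, (Finset.mem_filter.1 hl).2]

theorem restrict_union {ι : Type*} [DecidableEq ι] (v : ι → ℂ) {S S' : Finset ι} (h : Disjoint S S') :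
    restrict v (S ∪ S') = restrict v S + restrict v S' := by
  ext l
  by_cases h1 : l ∈ S
  · simp [restrict, h1, Finset.disjoint_left.1 h h1]
  · by_cases h2 : l ∈ S' <;> simp [restrict, h1, h2]

theorem restrict_univ (v : ι → ℂ) : restrict v Finset.univ = v := by ext l; simp [restrict]

theorem euclNorm_restrict_le_of_le (v : ι → ℂ) (S : Finset ι) {s : ℕ} (hs : S.card ≤ s) {M : ℝ}
    (hM : 0 ≤ M) (h : ∀ l ∈ S, ‖v l‖ ≤ M) : euclNorm (restrict v S) ≤ Real.sqrt s * M := by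
  refine abs_le_of_sq_le_sq' ?_ (by positivity) |>.2
  rw [euclNorm_restrict_sq, mul_pow, Real.sq_sqrt (Nat.cast_nonneg _)]
  calc ∑ l ∈ S, ‖v l‖ ^ 2 ≤ ∑ l ∈ S, M ^ 2 :=
        Finset.sum_le_sum fun l hl => pow_le_pow_left₀ (norm_nonneg _) (h l hl) 2
    _ = S.card * M ^ 2 := by simp
    _ ≤ s * M ^ 2 := by gcongr

theorem sum_norm_le_sqrt_mul (v : ι → ℂ) (S : Finset ι) :
    ∑ l ∈ S, ‖v l‖ ≤ Real.sqrt S.card * euclNorm (restrict v S) := by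
  refine abs_le_of_sq_le_sq' ?_ (mul_nonneg (Real.sqrt_nonneg _) (euclNorm_nonneg _)) |>.2
  rw [mul_pow, euclNorm_restrict_sq, Real.sq_sqrt (Nat.cast_nonneg _)]
  exact sq_sum_le_card_mul_sum_sq

end Restrict

/-- The indices of the `s` largest values of `a` on `U`. -/
theorem exists_largest {ι : Type*} [DecidableEq ι] (a : ι → ℝ) (s : ℕ) (U : Finset ι) (hs : s ≤ U.card) :
    ∃ V ⊆ U, V.card = s ∧ ∀ l ∈ V, ∀ l' ∈ U \ V, a l' ≤ a l := by
  induction s with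
  | zero => exact ⟨∅, by simp, by simp, by simp⟩
  | succ s ih =>
    obtain ⟨V, hVU, hV, hmax⟩ := ih (by omega)
    have hne : (U \ V).Nonempty := by
      rw [← Finset.card_pos, Finset.card_sdiff_of_subset hVU]; omega
    obtain ⟨b, hb, hbmax⟩ := Finset.exists_max_image (U \ V) a hne
    have hb' := Finset.mem_sdiff.1 hb
    refine ⟨insert b V, Finset.insert_subset hb'.1 hVU, ?_, ?_⟩
    · rw [Finset.card_insert_of_notMem hb'.2, hV]
    · intro l hl l' hl'
      have hl'' : l' ∈ U \ V := by
        simp only [Finset.mem_sdiff, Finset.mem_insert, not_or] at hl' ⊢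
        exact ⟨hl'.1, hl'.2.2⟩
      rcases Finset.mem_insert.1 hl with rfl | hl
      · exact hbmax l' hl''
      · exact hmax l hl l' hl''

/-- A functional that is bounded by `D` on vectors supported in few indices, estimated on a vector
with entries of size at most `M`. -/
theorem abs_le_of_sparse_bound [DecidableEq ι] (φ : (ι → ℂ) → ℝ)
    (hφ : ∀ u v, φ (u + v) = φ u + φ v) {s : ℕ} (hs : 0 < s) {D : ℝ} (hD : 0 ≤ D) (v : ι → ℂ)
    (n : ℕ) : ∀ U : Finset ι, U.card = n →
    (∀ S ⊆ U, S.card ≤ s → |φ (restrict v S)| ≤ D * euclNorm (restrict v S)) →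
    ∀ M : ℝ, 0 ≤ M → (∀ l ∈ U, ‖v l‖ ≤ M) →
    |φ (restrict v U)| ≤ D * (Real.sqrt s * M + (∑ l ∈ U, ‖v l‖) / Real.sqrt s) := by
  induction n using Nat.strong_induction_on with
  | _ n ih =>
  intro U hU hb M hM hle
  have hs' : 0 < Real.sqrt s := Real.sqrt_pos.2 (by exact_mod_cast hs)
  by_cases hUs : U.card ≤ s
  · refine (hb U subset_rfl hUs).trans ?_
    gcongr
    refine (euclNorm_restrict_le_of_le v U hUs hM hle).trans ?_
    exact le_add_of_nonneg_right (by positivity)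
  -- Peel off the `s` largest entries. Everything left is at most their average, which is the sup
  -- bound for the next round; so each later block is charged to the `ℓ¹` mass of the block before
  -- it.
  · obtain ⟨V, hVU, hV, hmax⟩ := exists_largest (fun l => ‖v l‖) s U (by omega)
    have hsplit : restrict v U = restrict v V + restrict v (U \ V) := by
      rw [← restrict_union v Finset.disjoint_sdiff, Finset.union_sdiff_of_subset hVU]
    have h1 : |φ (restrict v V)| ≤ D * (Real.sqrt s * M) := by
      refine (hb V hVU hV.le).trans ?_
      gcongr
      exact euclNorm_restrict_le_of_le v V hV.le hM fun l hl => hle l (hVU hl)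
    have h2 := ih (U \ V).card (by rw [Finset.card_sdiff_of_subset hVU]; omega) (U \ V) rfl
      (fun S hS => hb S (hS.trans Finset.sdiff_subset)) ((∑ l ∈ V, ‖v l‖) / s) (by positivity)
      (by
        intro l' hl'
        rw [le_div_iff₀ (by exact_mod_cast hs)]
        calc ‖v l'‖ * s = ∑ l ∈ V, ‖v l'‖ := by simp [hV, mul_comm]
          _ ≤ _ := Finset.sum_le_sum fun l hl => hmax l hl l' hl')
    have h3 : Real.sqrt s * ((∑ l ∈ V, ‖v l‖) / s) = (∑ l ∈ V, ‖v l‖) / Real.sqrt s := by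
      have : (s : ℝ) = Real.sqrt s * Real.sqrt s := (Real.mul_self_sqrt (Nat.cast_nonneg _)).symm
      rw [eq_div_iff hs'.ne']
      nth_rewrite 2 [this]
      field_simp
    rw [h3] at h2
    rw [hsplit, hφ]
    refine (abs_add_le _ _).trans ((add_le_add h1 h2).trans_eq ?_)
    rw [← Finset.sum_sdiff hVU]
    ring

/-- Using `b0 + b1 ≤ √2 b` and `b0 ≤ b`, one factor `b` cancels. The remaining coefficient `1 - δ -
√2 δ` is positive exactly when `δ < √2 - 1`. -/
theorem le_c₂_of_quadratic {δ ε b b0 b1 : ℝ} (hδ0 : 0 ≤ δ) (hδ : (1 + Real.sqrt 2) * δ < 1)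
    (hε0 : 0 ≤ ε) (hb : 0 ≤ b) (hb0 : 0 ≤ b0) (hb0b : b0 ≤ b) (hb01 : b0 + b1 ≤ Real.sqrt 2 * b)
    (hkey : (1 - δ) * b ^ 2 ≤ Real.sqrt (1 + δ) * b * (2 * ε) + δ * (b0 + b1) * b0) :
    b ≤ c₂ δ / 2 * ε := by
  have hden : 0 < 1 - (1 + Real.sqrt 2) * δ := by linarith
  have hk : δ * (b0 + b1) * b0 ≤ δ * (Real.sqrt 2 * b) * b := by gcongr
  rcases eq_or_lt_of_le hb with h0 | h0
  · rw [← h0]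
    unfold c₂
    positivity
  · have hk3 : (1 - (1 + Real.sqrt 2) * δ) * b ≤ Real.sqrt (1 + δ) * (2 * ε) := by
      refine le_of_mul_le_mul_right ?_ h0
      calc (1 - (1 + Real.sqrt 2) * δ) * b * b
          = (1 - δ) * b ^ 2 - δ * (Real.sqrt 2 * b) * b := by ring
        _ ≤ Real.sqrt (1 + δ) * b * (2 * ε) := by linarith
        _ = _ := by ring
    rw [c₂, div_div, div_mul_eq_mul_div, le_div_iff₀ (by positivity)]
    linarith

/-- Stability of `ℓ¹`-minimization: if `h` satisfies the cone condition on `T` and its image is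
small, then all entries of `h` are small. -/
theorem RIP.norm_le_of_cone [DecidableEq ι] {B : Matrix m ι ℂ} {s : ℕ} {δ : ℝ}
    (hB : RIP B (2 * s) δ) (hδ : (1 + Real.sqrt 2) * δ < 1) {T : Finset ι} (hT : T.card = s)
    (hs : 0 < s) {h : ι → ℂ} (hcone : ∑ l ∈ Tᶜ, ‖h l‖ ≤ ∑ l ∈ T, ‖h l‖) {ε : ℝ}
    (hε : euclNorm (B *ᵥ h) ≤ 2 * ε) (l : ι) : ‖h l‖ ≤ c₂ δ / 2 * ε := by
  have hδ0 := hB.1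
  have hs' : 0 < Real.sqrt s := Real.sqrt_pos.2 (by exact_mod_cast hs)
  have hs1 : (0 : ℝ) < s := by exact_mod_cast hs
  have hss : Real.sqrt s * Real.sqrt s = s := Real.mul_self_sqrt hs1.le
  -- `V` holds the `s` largest entries off `T`, or all of `Tᶜ` if there are fewer; then the last
  -- condition is void.
  obtain ⟨V, hVT, hVs, hV⟩ : ∃ V ⊆ Tᶜ, V.card ≤ s ∧
      ∀ l ∈ Tᶜ \ V, ‖h l‖ ≤ (∑ l ∈ V, ‖h l‖) / s := by
    by_cases hc : s ≤ Tᶜ.card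
    · obtain ⟨V, hVU, hV, hmax⟩ := exists_largest (fun l => ‖h l‖) s Tᶜ hc
      refine ⟨V, hVU, hV.le, fun l' hl' => ?_⟩
      rw [le_div_iff₀ hs1]
      calc ‖h l'‖ * s = ∑ l ∈ V, ‖h l'‖ := by simp [hV, mul_comm]
        _ ≤ _ := Finset.sum_le_sum fun l hl => hmax l hl l' hl'
    · exact ⟨Tᶜ, subset_rfl, by omega, by simp⟩
  have hTV : Disjoint T V :=
    Finset.disjoint_left.2 fun l hl hl' => (Finset.mem_compl.1 (hVT hl')) hl
  set U := Tᶜ \ V with hUdef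
  set W := T ∪ V with hWdef
  have hWU : Disjoint W U := by
    rw [Finset.disjoint_left]
    intro l hl hl'
    simp only [W, U, Finset.mem_union, Finset.mem_sdiff, Finset.mem_compl] at hl hl'
    tauto
  have hWUu : W ∪ U = Finset.univ := by
    ext l
    simp only [W, U, Finset.mem_union, Finset.mem_sdiff, Finset.mem_compl, Finset.mem_univ, iff_true]
    tauto
  have hWcard : W.card ≤ 2 * s := (Finset.card_union_le _ _).trans (by omega)
  set b := euclNorm (restrict h W) with hb
  set b0 := euclNorm (restrict h T) with hb0
  set b1 := euclNorm (restrict h V) with hb1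
  have hbn : 0 ≤ b := euclNorm_nonneg _
  have hb0n : 0 ≤ b0 := euclNorm_nonneg _
  have hb1n : 0 ≤ b1 := euclNorm_nonneg _
  have hbsq : b ^ 2 = b0 ^ 2 + b1 ^ 2 := by
    rw [hb, hb0, hb1, euclNorm_restrict_sq, euclNorm_restrict_sq, euclNorm_restrict_sq,
      Finset.sum_union hTV]
  have hb0b : b0 ≤ b := by
    refine abs_le_of_sq_le_sq' ?_ hbn |>.2
    nlinarith
  have hb1b : b1 ≤ b := by
    refine abs_le_of_sq_le_sq' ?_ hbn |>.2
    nlinarith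
  have hb01 : b0 + b1 ≤ Real.sqrt 2 * b := by
    refine abs_le_of_sq_le_sq' ?_ (by positivity) |>.2
    rw [mul_pow, Real.sq_sqrt (by norm_num), hbsq]
    nlinarith [sq_nonneg (b0 - b1)]
  -- `W` may already have `2s` indices, so order `2s` allows only `T` and `V` separately to be
  -- paired with a block. The block bounds add up to the `ℓ¹` mass on `Tᶜ` over `√s`, which the cone
  -- condition bounds by `b0`.
  have hrest : |reInner (B *ᵥ restrict h W) (B *ᵥ restrict h U)| ≤ δ * (b0 + b1) * b0 := by
    have hsub : ∀ S ⊆ U, S.card ≤ s →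
        |reInner (B *ᵥ restrict h W) (B *ᵥ restrict h S)| ≤
          δ * (b0 + b1) * euclNorm (restrict h S) := by
      intro S hS hSs
      have hSW : Disjoint W S := hWU.mono_right hS
      rw [hWdef, Finset.disjoint_union_left] at hSW
      rw [hWdef, restrict_union h hTV, Matrix.mulVec_add, reInner_add_left]
      have e1 := hB.abs_reInner_le (fun l hl => restrict_of_notMem h T hl)
        (fun l hl => restrict_of_notMem h S hl) hSW.1 (by omega)
      have e2 := hB.abs_reInner_le (fun l hl => restrict_of_notMem h V hl)
        (fun l hl => restrict_of_notMem h S hl) hSW.2 (by omega)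
      refine (abs_add_le _ _).trans ((add_le_add e1 e2).trans_eq ?_)
      ring
    refine (abs_le_of_sparse_bound (fun u => reInner (B *ᵥ restrict h W) (B *ᵥ u))
      (fun u v => by simp only [Matrix.mulVec_add, reInner_add_right]) hs
      (by positivity : 0 ≤ δ * (b0 + b1)) h U.card U rfl hsub _ (by positivity) hV).trans ?_
    gcongr
    have h3 : Real.sqrt s * ((∑ l ∈ V, ‖h l‖) / s) = (∑ l ∈ V, ‖h l‖) / Real.sqrt s := by
      rw [eq_div_iff hs'.ne']
      nth_rewrite 2 [← hss]
      field_simp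
    rw [h3, ← add_div, div_le_iff₀ hs', add_comm, hUdef, Finset.sum_sdiff hVT, mul_comm]
    refine hcone.trans ?_
    have := sum_norm_le_sqrt_mul h T
    rwa [hT] at this
  have hW1 := hB.of_support (fun l hl => restrict_of_notMem h W hl) hWcard
  have hkey : (1 - δ) * b ^ 2 ≤ Real.sqrt (1 + δ) * b * (2 * ε) + δ * (b0 + b1) * b0 := by
    have e1 : B *ᵥ h = B *ᵥ restrict h W + B *ᵥ restrict h U := by
      rw [← Matrix.mulVec_add, ← restrict_union h hWU, hWUu, restrict_univ]
    have e2 : euclNorm (B *ᵥ restrict h W) ^ 2 = reInner (B *ᵥ restrict h W) (B *ᵥ h) -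
        reInner (B *ᵥ restrict h W) (B *ᵥ restrict h U) := by
      rw [e1, reInner_add_right, reInner_self]; ring
    have e3 : reInner (B *ᵥ restrict h W) (B *ᵥ h) ≤ Real.sqrt (1 + δ) * b * (2 * ε) := by
      refine (le_abs_self _).trans ((CRAN.abs_reInner_le _ _).trans ?_)
      have : euclNorm (B *ᵥ restrict h W) ≤ Real.sqrt (1 + δ) * b := by
        refine abs_le_of_sq_le_sq' ?_ (by positivity) |>.2
        rw [mul_pow, Real.sq_sqrt (by linarith)]
        exact hW1.2
      exact mul_le_mul this hε (euclNorm_nonneg _) (by positivity)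
    have e4 := (abs_le.1 hrest).1
    linarith [hW1.1]
  have hε0 : 0 ≤ ε := by linarith [euclNorm_nonneg (B *ᵥ h)]
  have hbfin : b ≤ c₂ δ / 2 * ε := le_c₂_of_quadratic hδ0 hδ hε0 hbn hb0n hb0b hb01 hkey
  -- Only single entries are wanted, so the tail costs nothing: an entry outside `W` is at most the
  -- average over `V`, hence at most `b1`. This is why half of `c₂` suffices.
  refine le_trans ?_ hbfin
  by_cases hlW : l ∈ W
  · have := norm_le_euclNorm (restrict h W) l
    simpa [restrict, hlW] using this
  · have hlU : l ∈ U := by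
      have : l ∈ W ∪ U := by rw [hWUu]; exact Finset.mem_univ _
      exact (Finset.mem_union.1 this).resolve_left hlW
    refine (hV l hlU).trans (le_trans ?_ hb1b)
    rw [div_le_iff₀ hs1]
    refine (sum_norm_le_sqrt_mul h V).trans ?_
    rw [mul_comm]
    refine mul_le_mul_of_nonneg_left ?_ hb1n
    refine Real.sqrt_le_iff.2 ⟨by positivity, ?_⟩
    have h1 : (V.card : ℝ) ≤ s := by exact_mod_cast hVs
    have h2 : (1 : ℝ) ≤ s := by exact_mod_cast hs
    nlinarith

/-- Since `y` has no larger `ℓ¹` norm than `x`, any mass it puts off `T` is compensated by a loss on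
`T`, and the triangle inequality bounds that loss. -/
theorem sum_compl_norm_sub_le [DecidableEq ι] {T : Finset ι} {x y : ι → ℂ} (hx : ∀ l ∉ T, x l = 0)
    (hy : ∑ l, ‖y l‖ ≤ ∑ l, ‖x l‖) :
    ∑ l ∈ Tᶜ, ‖(y - x) l‖ ≤ ∑ l ∈ T, ‖(y - x) l‖ := by
  rw [← Finset.sum_add_sum_compl T, ← Finset.sum_add_sum_compl T (fun l => ‖x l‖)] at hy
  have h1 : ∑ l ∈ Tᶜ, ‖(y - x) l‖ = ∑ l ∈ Tᶜ, ‖y l‖ :=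
    Finset.sum_congr rfl fun l hl => by simp [hx l (Finset.mem_compl.1 hl)]
  have h2 : ∑ l ∈ Tᶜ, ‖x l‖ = 0 :=
    Finset.sum_eq_zero fun l hl => by simp [hx l (Finset.mem_compl.1 hl)]
  have h3 : ∑ l ∈ T, ‖x l‖ - ∑ l ∈ T, ‖y l‖ ≤ ∑ l ∈ T, ‖(y - x) l‖ := by
    rw [← Finset.sum_sub_distrib]
    refine Finset.sum_le_sum fun l _ => ?_
    rw [Pi.sub_apply, norm_sub_rev]
    exact norm_sub_norm_le _ _
  linarith

/-- Stability of basis pursuit for a matrix that satisfies a scaled restricted isometry property. -/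
theorem IsBasisPursuit.norm_sub_le [DecidableEq ι] {B : Matrix m ι ℂ} {s : ℕ} {δ t : ℝ} (ht : 0 < t)
    (hB : RIP ((t⁻¹ : ℂ) • B) (2 * s) δ) (hδ : (1 + Real.sqrt 2) * δ < 1) {T : Finset ι}
    (hT : T.card = s) (hs : 0 < s) {x y : ι → ℂ} (hx : ∀ l ∉ T, x l = 0) {z : m → ℂ} {lam : ℝ}
    (hz : euclNorm (B *ᵥ x - z) ≤ lam) (hy : IsBasisPursuit B z lam y) (l : ι) :
    ‖y l - x l‖ ≤ c₂ δ / 2 * (lam / t) := by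
  obtain ⟨hy1, hy2⟩ := hy ⟨x, hz⟩
  refine hB.norm_le_of_cone hδ hT hs (sum_compl_norm_sub_le hx (hy2 x hz)) ?_ l
  rw [Matrix.smul_mulVec, euclNorm_smul, norm_inv, Complex.norm_real, Real.norm_of_nonneg ht.le]
  have : B *ᵥ (y - x) = (B *ᵥ y - z) - (B *ᵥ x - z) := by rw [Matrix.mulVec_sub]; abel
  rw [this, inv_mul_le_iff₀ ht]
  refine (euclNorm_sub_le _ _).trans ?_
  have : t * (2 * (lam / t)) = lam + lam := by field_simp; ring
  linarith

end Recovery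

/-! ## Residuals and greedy detection -/

section Detection

variable {m ι : Type*} [Fintype m] [Fintype ι] [DecidableEq ι]

/-- By the Penrose equations the matrix is a self-adjoint idempotent `Q`, so `‖Qv‖² = Re ⟨v, Qv⟩`.
-/
theorem euclNorm_one_sub_mul_pinv_mulVec_le {n : Type*} [Fintype n] [DecidableEq n] [DecidableEq m]
    (B : Matrix m n ℂ) (v : m → ℂ) : euclNorm ((1 - B * pinv B) *ᵥ v) ≤ euclNorm v := by
  obtain ⟨h1, -, h3, -⟩ := pinv_spec B
  set Q := 1 - B * pinv B with hQ
  have hQh : Qᴴ = Q := by rw [hQ, Matrix.conjTranspose_sub, h3, Matrix.conjTranspose_one]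
  have hQQ : Q * Q = Q := by
    have : B * pinv B * (B * pinv B) = B * pinv B := by rw [← Matrix.mul_assoc, h1]
    rw [hQ, mul_sub, sub_mul, sub_mul, this]
    simp
  have hsq : euclNorm (Q *ᵥ v) ^ 2 ≤ euclNorm v * euclNorm (Q *ᵥ v) := by
    have e : reInner (Q *ᵥ v) (Q *ᵥ v) = reInner v (Q *ᵥ v) := by
      simp only [reInner, EuclideanSpace.inner_eq_star_dotProduct]
      rw [dotProduct_comm, dotProduct_comm (Q *ᵥ v), Matrix.star_mulVec, hQh, ← Matrix.dotProduct_mulVec,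
        Matrix.mulVec_mulVec, hQQ]
    rw [← reInner_self, e]
    exact (le_abs_self _).trans (abs_reInner_le _ _)
  rcases eq_or_lt_of_le (euclNorm_nonneg (Q *ᵥ v)) with h0 | h0
  · rw [← h0]; exact euclNorm_nonneg _
  · nlinarith

theorem cols_mulVec_eq {m ι : Type*} [Fintype ι] (Θ : Matrix m ι ℂ) (S : Finset ι) {x : ι → ℂ} (hx : ∀ l ∉ S, x l = 0) :
    cols Θ S *ᵥ (fun l : S => x l) = Θ *ᵥ x := by
  ext p
  simp only [Matrix.mulVec, dotProduct, cols, Matrix.submatrix_apply, id]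
  rw [Finset.sum_coe_sort S (fun l => Θ p l * x l)]
  exact Finset.sum_subset (Finset.subset_univ S) fun l _ hl => by simp [hx l hl]

/-- Extension of a vector by zero. -/
def extend {ι : Type*} [DecidableEq ι] (S : Finset ι) (y : S → ℂ) : ι → ℂ := fun l => if h : l ∈ S then y ⟨l, h⟩ else 0

theorem extend_of_notMem {ι : Type*} [DecidableEq ι] (S : Finset ι) (y : S → ℂ) {l : ι} (hl : l ∉ S) : extend S y l = 0 :=
  dif_neg hl

theorem cols_mulVec {m ι : Type*} [Fintype ι] [DecidableEq ι] (Θ : Matrix m ι ℂ) (S : Finset ι) (y : S → ℂ) :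
    cols Θ S *ᵥ y = Θ *ᵥ extend S y := by
  rw [← cols_mulVec_eq Θ S fun l hl => extend_of_notMem S y hl]
  congr 1
  ext l
  simp [extend]

theorem euclNorm_extend (S : Finset ι) (y : S → ℂ) : euclNorm (extend S y) = euclNorm y := by
  have h : euclNorm (extend S y) ^ 2 = euclNorm y ^ 2 := by
    rw [euclNorm_sq, euclNorm_sq, ← Finset.sum_subset (Finset.subset_univ S)]
    · rw [← Finset.sum_coe_sort S]
      exact Finset.sum_congr rfl fun l _ => by simp [extend]
    · intro l _ hl
      simp [extend, hl]
  exact (sq_eq_sq₀ (euclNorm_nonneg _) (euclNorm_nonneg _)).1 h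

/-- `Θ` is bounded from below by `κ` on the vectors supported in `T`. -/
def BoundedBelowOn (Θ : Matrix m ι ℂ) (T : Finset ι) (κ : ℝ) : Prop :=
  ∀ v : ι → ℂ, (∀ l ∉ T, v l = 0) → κ * euclNorm v ≤ euclNorm (Θ *ᵥ v)

theorem BoundedBelowOn.cols {Θ : Matrix m ι ℂ} {T : Finset ι} {κ : ℝ} (h : BoundedBelowOn Θ T κ)
    (y : T → ℂ) : κ * euclNorm y ≤ euclNorm (cols Θ T *ᵥ y) := by
  rw [cols_mulVec, ← euclNorm_extend]
  exact h _ fun l hl => extend_of_notMem T y hl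

theorem BoundedBelowOn.cols_injective {Θ : Matrix m ι ℂ} {T : Finset ι} {κ : ℝ} (hκ : 0 < κ)
    (h : BoundedBelowOn Θ T κ) : Function.Injective (CRAN.cols Θ T).mulVec := by
  have h0 : ∀ y : T → ℂ, CRAN.cols Θ T *ᵥ y = 0 → y = 0 := by
    intro y hy
    have h1 := h.cols y
    rw [hy, euclNorm_eq_zero.2 rfl] at h1
    refine euclNorm_eq_zero.1 (le_antisymm ?_ (euclNorm_nonneg _))
    by_contra hc
    push Not at hc
    nlinarith
  intro y y' hy
  refine sub_eq_zero.1 (h0 _ ?_)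
  rw [Matrix.mulVec_sub]
  exact sub_eq_zero.2 hy

theorem BoundedBelowOn.isUnit_gram {Θ : Matrix m ι ℂ} {T : Finset ι} {κ : ℝ} (hκ : 0 < κ)
    (h : BoundedBelowOn Θ T κ) : IsUnit ((CRAN.cols Θ T)ᴴ * CRAN.cols Θ T) := by
  rw [← Matrix.mulVec_injective_iff_isUnit]
  have hk : ∀ y : T → ℂ, ((CRAN.cols Θ T)ᴴ * CRAN.cols Θ T) *ᵥ y = 0 → y = 0 := by
    intro y hy
    have h1 : star (CRAN.cols Θ T *ᵥ y) ⬝ᵥ (CRAN.cols Θ T *ᵥ y) = 0 := by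
      rw [Matrix.star_mulVec, ← Matrix.dotProduct_mulVec, Matrix.mulVec_mulVec, hy, dotProduct_zero]
    rw [star_dotProduct_self_eq] at h1
    have h2 : euclNorm (CRAN.cols Θ T *ᵥ y) = 0 := by
      have : euclNorm (CRAN.cols Θ T *ᵥ y) ^ 2 = 0 := by exact_mod_cast h1
      exact pow_eq_zero_iff (two_ne_zero) |>.1 this
    refine h.cols_injective hκ ?_
    rw [euclNorm_eq_zero.1 h2, Matrix.mulVec_zero]
  intro y y' hy
  refine sub_eq_zero.1 (hk _ ?_)
  rw [Matrix.mulVec_sub]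
  exact sub_eq_zero.2 hy

/-- Ensures that the cap of `M R` users cannot stop the greedy selection before all of `T` is taken.
-/
theorem BoundedBelowOn.card_le {Θ : Matrix m ι ℂ} {T : Finset ι} {κ : ℝ} (hκ : 0 < κ)
    (h : BoundedBelowOn Θ T κ) : T.card ≤ Fintype.card m := by
  have := LinearMap.finrank_le_finrank_of_injective (f := Matrix.mulVecLin (CRAN.cols Θ T))
    (h.cols_injective hκ)
  simpa using this

/-- The signal lies in the column space of `cols Θ T` and is projected away; only noise survives. -/
theorem residual_le_of_support [DecidableEq m] (Θ : Matrix m ι ℂ) {T : Finset ι} {x : ι → ℂ}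
    (hx : ∀ l ∉ T, x l = 0) (e : m → ℂ) : residual Θ (Θ *ᵥ x + e) T ≤ euclNorm e := by
  have h0 : (1 - cols Θ T * pinv (cols Θ T)) *ᵥ (Θ *ᵥ x) = 0 := by
    rw [← cols_mulVec_eq Θ T hx, Matrix.mulVec_mulVec, Matrix.sub_mul, (pinv_spec (cols Θ T)).1,
      Matrix.one_mul,
      sub_self, Matrix.zero_mulVec]
  rw [residual, Matrix.mulVec_add, h0, zero_add]
  exact euclNorm_one_sub_mul_pinv_mulVec_le _ _

/-- Projecting off the columns in `S` changes `x` only on `S`, so the missed coordinate `l` stays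
intact and the lower bound on `T` sees it. -/
theorem BoundedBelowOn.le_residual [DecidableEq m] {Θ : Matrix m ι ℂ} {T S : Finset ι} {κ : ℝ}
    (hκ : 0 < κ) (h : BoundedBelowOn Θ T κ) (hS : S ⊆ T) {x : ι → ℂ} (hx : ∀ l ∉ T, x l = 0)
    (e : m → ℂ) {l : ι} (hlS : l ∉ S) :
    κ * ‖x l‖ - euclNorm e ≤ residual Θ (Θ *ᵥ x + e) S := by
  set Q := 1 - CRAN.cols Θ S * pinv (CRAN.cols Θ S) with hQ
  set y := extend S (pinv (CRAN.cols Θ S) *ᵥ (Θ *ᵥ x)) with hy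
  have h1 : Q *ᵥ (Θ *ᵥ x) = Θ *ᵥ (x - y) := by
    rw [hQ, Matrix.sub_mulVec, Matrix.one_mulVec, Matrix.mulVec_sub, ← Matrix.mulVec_mulVec,
      cols_mulVec]
  have h2 : κ * ‖x l‖ ≤ euclNorm (Q *ᵥ (Θ *ᵥ x)) := by
    rw [h1]
    refine le_trans ?_ (h (x - y) fun l hl => ?_)
    · have := norm_le_euclNorm (x - y) l
      rw [Pi.sub_apply, hy, extend_of_notMem S _ hlS, sub_zero] at this
      gcongr
    · rw [Pi.sub_apply, hx l hl, hy, extend_of_notMem S _ fun h => hl (hS h), sub_zero]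
  have h3 : Q *ᵥ (Θ *ᵥ x) = Q *ᵥ (Θ *ᵥ x + e) - Q *ᵥ e := by
    rw [Matrix.mulVec_add, add_sub_cancel_right]
  have h4 := euclNorm_sub_le (Q *ᵥ (Θ *ᵥ x + e)) (Q *ᵥ e)
  rw [← h3] at h4
  have h5 := euclNorm_one_sub_mul_pinv_mulVec_le (CRAN.cols Θ S) e
  rw [residual]
  linarith

theorem card_firstUsers {K Nc : ℕ} (σ : Fin (Nc * K) ≃ UE K Nc) {k : ℕ} (hk : k ≤ Nc * K) :
    (firstUsers σ k).card = k := by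
  rw [firstUsers, Finset.card_image_of_injective _ σ.injective, Fin.card_filter_val_lt,
    min_eq_right hk]

theorem mem_firstUsers {K Nc : ℕ} (σ : Fin (Nc * K) ≃ UE K Nc) {k : ℕ} {l : UE K Nc} :
    l ∈ firstUsers σ k ↔ ((σ.symm l : Fin (Nc * K)) : ℕ) < k := by
  simp only [firstUsers, Finset.mem_image, Finset.mem_filter, Finset.mem_univ, true_and]
  constructor
  · rintro ⟨j, hj, rfl⟩; simpa using hj
  · intro h; exact ⟨σ.symm l, h, by simp⟩

/-- The level `η` separates `T` from the rest, so a user outside `T` is preceded by all of `T` and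
its zero-based position is at least `T.card`. -/
theorem firstUsers_subset {K Nc : ℕ} (σ : Fin (Nc * K) ≃ UE K Nc) {a : UE K Nc → ℝ}
    (hσ : Antitone fun j => a (σ j)) {T : Finset (UE K Nc)} {η : ℝ} (h1 : ∀ l ∈ T, η < a l)
    (h2 : ∀ l ∉ T, a l ≤ η) {k : ℕ} (hk : k ≤ T.card) : firstUsers σ k ⊆ T := by
  intro l hl
  rw [mem_firstUsers] at hl
  by_contra hlT
  have hsub : T ⊆ firstUsers σ (σ.symm l : Fin (Nc * K)) := by
    intro l' hl'
    rw [mem_firstUsers]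
    by_contra hc
    push Not at hc
    have := hσ (show σ.symm l ≤ σ.symm l' from hc)
    simp only [Equiv.apply_symm_apply] at this
    linarith [h1 l' hl', h2 l hlT]
  have := Finset.card_le_card hsub
  rw [card_firstUsers σ (σ.symm l).2.le] at this
  omega

/-- Detection succeeds if the noise is small and the active symbols are large. -/
theorem IsDetected.eq_of_rip {M K Nc R : ℕ} {Θ : Matrix (Fin R × Fin M) (UE K Nc) ℂ} {δ t : ℝ}
    (ht : 0 < t) {T That : Finset (UE K Nc)}
    (hΘ : RIP ((t⁻¹ : ℂ) • Θ) (2 * T.card) δ) (hδ : (1 + Real.sqrt 2) * δ < 1)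
    (hs : 0 < T.card) {x : UE K Nc → ℂ} (hx : ∀ l ∉ T, x l = 0) {e : Fin R × Fin M → ℂ} {lam : ℝ}
    (he : euclNorm e ≤ lam) {κ : ℝ} (hκ : 0 < κ) (hlow : BoundedBelowOn Θ T κ)
    (hx1 : ∀ l ∈ T, c₂ δ * (lam / t) < ‖x l‖) (hx2 : ∀ l ∈ T, 2 * lam < κ * ‖x l‖)
    (hdet : IsDetected Θ (Θ *ᵥ x + e) lam That) : That = T := by
  obtain ⟨y, hy, σ, hσ, k, hk1, hkN, rfl, hterm, hmin⟩ := hdet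
  have hz : euclNorm (Θ *ᵥ x - (Θ *ᵥ x + e)) ≤ lam := by
    rwa [sub_add_cancel_left, euclNorm_neg]
  have herr := hy.norm_sub_le ht hΘ hδ rfl hs hx hz
  have hbig : ∀ l ∈ T, c₂ δ / 2 * (lam / t) < ‖y l‖ := by
    intro l hl
    have h1 := herr l
    have h2 := hx1 l hl
    have h3 := norm_sub_norm_le (x l) (y l)
    rw [norm_sub_rev] at h3
    linarith
  have hsmall : ∀ l ∉ T, ‖y l‖ ≤ c₂ δ / 2 * (lam / t) := by
    intro l hl
    simpa [hx l hl] using herr l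
  have hsub : ∀ {j : ℕ}, j ≤ T.card → firstUsers σ j ⊆ T := fun hj =>
    firstUsers_subset σ (a := fun l => ‖y l‖) hσ hbig hsmall hj
  have hTN : T.card ≤ Nc * K := by
    simpa using Finset.card_le_univ T
  have hT : firstUsers σ T.card = T :=
    Finset.eq_of_subset_of_card_le (hsub le_rfl) (card_firstUsers σ hTN).ge
  have hTm : T.card ≤ M * R := by
    simpa [mul_comm] using hlow.card_le hκ
  rcases lt_trichotomy k T.card with hk | hk | hk
  -- Stopping too early: a missed active user keeps the residual above `2 lam - lam`, and both caps
  -- are at least `T.card`.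
  · exfalso
    obtain ⟨l, hlT, hl⟩ : ∃ l ∈ T, l ∉ firstUsers σ k := by
      by_contra! hc
      have := Finset.card_le_card hc
      rw [card_firstUsers σ hkN] at this
      omega
    have h1 := hlow.le_residual hκ (hsub hk.le) hx e hl
    have h2 := hx2 l hlT
    rcases hterm with h | h | h
    · linarith
    · omega
    · omega
  · rw [hk, hT]
  -- Stopping too late: after `T.card` users the set is `T`, and its residual is already at most
  -- `lam`.
  · exact absurd (Or.inl (by rw [hT]; exact (residual_le_of_support Θ hx e).trans he))
      (hmin T.card hs hk)

end Detection

/-! ## The rate for a given matrix -/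

section Rate

variable {m q ι : Type*} [Fintype m] [Fintype q] [DecidableEq ι]

theorem mul_conjTranspose_self_diag_re {n r : Type*} [Fintype r] (X : Matrix n r ℂ) (l : n) :
    ((X * Xᴴ) l l).re = euclNorm (X l) ^ 2 := by
  rw [euclNorm_sq, Matrix.mul_apply, Complex.re_sum]
  refine Finset.sum_congr rfl fun j _ => ?_
  rw [Matrix.conjTranspose_apply, RCLike.star_def, RCLike.mul_conj]
  norm_cast

theorem covariance_diag_re (Θ : Matrix m ι ℂ) (A : Matrix m q ℂ) (P : ℝ) (T That : Finset ι)
    (l : That) : (covariance Θ A P T That l l).re =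
      P * euclNorm (pinv (cols Θ That) l ᵥ* cols Θ (T \ That)) ^ 2 +
        euclNorm (pinv (cols Θ That) l ᵥ* A) ^ 2 := by
  set W := pinv (cols Θ That)
  set B := cols Θ (T \ That)
  have h : covariance Θ A P T That = (P : ℂ) • ((W * B) * (W * B)ᴴ) + (W * A) * (W * A)ᴴ := by
    rw [covariance, Matrix.conjTranspose_mul, Matrix.conjTranspose_mul]
    simp only [Matrix.mul_add, Matrix.add_mul, Matrix.mul_smul, Matrix.smul_mul, Matrix.mul_assoc]
    rfl
  rw [h, Matrix.add_apply, Complex.add_re, mul_conjTranspose_self_diag_re, Matrix.smul_apply,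
    smul_eq_mul, Complex.re_ofReal_mul, mul_conjTranspose_self_diag_re]
  rfl

theorem le_covariance_diag_re (Θ : Matrix m ι ℂ) (A : Matrix m q ℂ) {P : ℝ} (hP : 0 ≤ P)
    (T That : Finset ι) (l : That) :
    euclNorm (pinv (cols Θ That) l ᵥ* A) ^ 2 ≤ (covariance Θ A P T That l l).re := by
  rw [covariance_diag_re]
  exact le_add_of_nonneg_left (by positivity)

theorem covariance_self_diag_re (Θ : Matrix m ι ℂ) (A : Matrix m q ℂ) (P : ℝ) (T : Finset ι)
    (l : T) : (covariance Θ A P T T l l).re = euclNorm (pinv (cols Θ T) l ᵥ* A) ^ 2 := by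
  rw [covariance_diag_re, add_eq_right, euclNorm_sq, Finset.sum_eq_zero, mul_zero]
  rintro ⟨j, hj⟩ _
  simp at hj

theorem sumRate_nonneg (Θ : Matrix m ι ℂ) (A : Matrix m q ℂ) {P : ℝ} (hP : 0 ≤ P)
    (T That : Finset ι) : 0 ≤ sumRate Θ A P T That := by
  unfold sumRate
  split_ifs
  · refine Finset.sum_nonneg fun l _ => Real.log_nonneg ?_
    have h := (sq_nonneg _).trans (le_covariance_diag_re Θ A hP T That l)
    refine le_add_of_nonneg_right (div_nonneg ?_ h)
    split_ifs <;> simp [hP]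
  · rfl

theorem pinv_mul_self_of_isUnit {n : Type*} [Fintype n] [DecidableEq n] {B : Matrix m n ℂ}
    (hB : IsUnit (Bᴴ * B)) : pinv B * B = 1 := by
  rw [(pinv_spec B).2.2.2.2 hB, Matrix.mul_assoc]
  exact Matrix.nonsing_inv_mul _ ((Matrix.isUnit_iff_isUnit_det _).1 hB)

/-- The only property of zero forcing that the upper bound uses: unit gain towards the user itself.
Nulling of the other users plays no role. -/
theorem pinv_row_vecMul_eq_one {Θ : Matrix m ι ℂ} {S : Finset ι}
    (hS : IsUnit ((cols Θ S)ᴴ * cols Θ S)) (l : S) : (pinv (cols Θ S) l ᵥ* Θ) l = 1 := by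
  have h : (pinv (cols Θ S) * cols Θ S) l l = 1 := by rw [pinv_mul_self_of_isUnit hS]; simp
  rwa [Matrix.mul_apply] at h

/-- With `y` the column `l` of the inverse Gram matrix, `star w = B y` and `‖w‖² = Re (y l) ≤ ‖y‖ ≤
κ⁻¹ ‖w‖`. -/
theorem BoundedBelowOn.euclNorm_pinv_row_le [Fintype ι] {Θ : Matrix m ι ℂ} {T : Finset ι} {κ : ℝ}
    (hκ : 0 < κ) (h : BoundedBelowOn Θ T κ) (l : T) : euclNorm (pinv (CRAN.cols Θ T) l) ≤ κ⁻¹ := by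
  set B := CRAN.cols Θ T with hB
  have hU := h.isUnit_gram hκ
  set G := Bᴴ * B with hG
  have hW : pinv B = G⁻¹ * Bᴴ := (pinv_spec B).2.2.2.2 hU
  have hGh : G⁻¹ᴴ = G⁻¹ := by
    rw [Matrix.conjTranspose_nonsing_inv, hG, Matrix.conjTranspose_mul,
      Matrix.conjTranspose_conjTranspose]
  have hWh : (pinv B)ᴴ = B * G⁻¹ := by
    rw [hW, Matrix.conjTranspose_mul, Matrix.conjTranspose_conjTranspose, hGh]
  set w := pinv B l with hw
  set y : T → ℂ := fun j => G⁻¹ j l with hy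
  have hstar : B *ᵥ y = star w := by
    ext p
    have := congr_fun (congr_fun hWh p) l
    rw [Matrix.mul_apply] at this
    exact this.symm
  have hnorm : euclNorm (star w) = euclNorm w := by
    have : euclNorm (star w) ^ 2 = euclNorm w ^ 2 := by simp [euclNorm_sq]
    exact (sq_eq_sq₀ (euclNorm_nonneg _) (euclNorm_nonneg _)).1 this
  have hyl : euclNorm w ^ 2 = (y l).re := by
    rw [← mul_conjTranspose_self_diag_re, hWh, ← Matrix.mul_assoc, pinv_mul_self_of_isUnit hU,
      one_mul]
  have h1 := h.cols y
  rw [← hB, hstar, hnorm] at h1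
  have h2 : (y l).re ≤ euclNorm y := (Complex.re_le_norm _).trans (norm_le_euclNorm y l)
  rw [← one_div, le_div_iff₀ hκ]
  rcases eq_or_lt_of_le (euclNorm_nonneg w) with h0 | h0
  · rw [← h0]; simp
  · nlinarith

end Rate

/-! ## Leverage scores -/

section Leverage

variable {m n : Type*} [Fintype m] [Fintype n]

/-- The leverage score of the column `c`: the largest value of `|u c|² / ‖u‖²` for `u` in the row
space of `A`. -/
noncomputable def leverage (A : Matrix m n ℂ) (c : n) : ℝ :=
  ⨆ k : ℕ, ‖(TopologicalSpace.denseSeq (m → ℂ) k ᵥ* A) c‖ ^ 2 /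
    euclNorm (TopologicalSpace.denseSeq (m → ℂ) k ᵥ* A) ^ 2

theorem norm_sq_div_euclNorm_sq_le_one (u : n → ℂ) (c : n) : ‖u c‖ ^ 2 / euclNorm u ^ 2 ≤ 1 := by
  refine div_le_one_of_le₀ ?_ (sq_nonneg _)
  have := norm_le_euclNorm u c
  gcongr

theorem bddAbove_leverage (A : Matrix m n ℂ) (c : n) : BddAbove (Set.range fun k : ℕ =>
    ‖(TopologicalSpace.denseSeq (m → ℂ) k ᵥ* A) c‖ ^ 2 /
      euclNorm (TopologicalSpace.denseSeq (m → ℂ) k ᵥ* A) ^ 2) :=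
  ⟨1, by rintro _ ⟨k, rfl⟩; exact norm_sq_div_euclNorm_sq_le_one _ c⟩

theorem leverage_nonneg (A : Matrix m n ℂ) (c : n) : 0 ≤ leverage A c :=
  Real.iSup_nonneg fun k => by positivity

theorem leverage_le_one (A : Matrix m n ℂ) (c : n) : leverage A c ≤ 1 :=
  ciSup_le fun _ => norm_sq_div_euclNorm_sq_le_one _ c

/-- The supremum runs over a dense sequence to be measurable in `A`. The multiplied-out inequality
is a closed condition on `w`, unlike the quotient near zero, so it passes to all `w`. -/
theorem norm_vecMul_sq_le_leverage (A : Matrix m n ℂ) (c : n) (w : m → ℂ) :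
    ‖(w ᵥ* A) c‖ ^ 2 ≤ leverage A c * euclNorm (w ᵥ* A) ^ 2 := by
  have hcont : Continuous fun w : m → ℂ => w ᵥ* A := continuous_id.matrix_vecMul continuous_const
  have hclosed : IsClosed {w : m → ℂ | ‖(w ᵥ* A) c‖ ^ 2 ≤ leverage A c * euclNorm (w ᵥ* A) ^ 2} := by
    simp only [euclNorm_sq]
    refine isClosed_le ?_ ?_
    · exact (((continuous_apply c).comp hcont).norm.pow 2)
    · exact continuous_const.mul (continuous_finsetSum _ fun i _ =>
        ((continuous_apply i).comp hcont).norm.pow 2)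
  refine hclosed.closure_subset_iff.2 ?_ ((TopologicalSpace.denseRange_denseSeq (m → ℂ)) w)
  rintro _ ⟨k, rfl⟩
  have h := le_ciSup (bddAbove_leverage A c) k
  rcases eq_or_ne (euclNorm (TopologicalSpace.denseSeq (m → ℂ) k ᵥ* A)) 0 with h0 | h0
  · rw [Set.mem_ofPred_eq, euclNorm_eq_zero.1 h0, Pi.zero_apply, norm_zero, zero_pow two_ne_zero]
    exact mul_nonneg (leverage_nonneg _ _) (sq_nonneg _)
  · exact (div_le_iff₀ (by positivity)).1 h

/-- In an orthonormal basis `b` of the row space, Cauchy–Schwarz bounds the score of `c` by `∑ j, |b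
j c|²`. Summing over `c` gives the dimension of the row space. -/
theorem sum_leverage_le (A : Matrix m n ℂ) : ∑ c, leverage A c ≤ Fintype.card m := by
  let φ : (m → ℂ) →ₗ[ℂ] EuclideanSpace ℂ n :=
    (WithLp.linearEquiv 2 ℂ (n → ℂ)).symm.toLinearMap ∘ₗ A.vecMulLinear
  let b := stdOrthonormalBasis ℂ φ.range
  have hφ : ∀ w, φ w = WithLp.toLp 2 (w ᵥ* A) := fun w => rfl
  have hle : ∀ c, leverage A c ≤ ∑ j, ‖(b j : EuclideanSpace ℂ n) c‖ ^ 2 := by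
    intro c
    refine ciSup_le fun k => div_le_of_le_mul₀ (sq_nonneg _) (by positivity) ?_
    set w := TopologicalSpace.denseSeq (m → ℂ) k
    let u : φ.range := ⟨φ w, ⟨w, rfl⟩⟩
    have hu : ∑ j, inner ℂ (b j) u • (b j : EuclideanSpace ℂ n) = φ w := by
      have := congrArg (Submodule.subtype _) (b.sum_repr' u)
      simpa using this
    have huc : (w ᵥ* A) c = ∑ j, inner ℂ (b j) u * (b j : EuclideanSpace ℂ n) c := by
      have := congrArg (fun v : EuclideanSpace ℂ n => v c) hu
      simp only [hφ] at this
      rw [← this]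
      simp
    have hun : ∑ j, ‖inner ℂ (b j) u‖ ^ 2 = euclNorm (w ᵥ* A) ^ 2 := by
      rw [b.sum_sq_norm_inner_right]; rfl
    rw [huc, ← hun, mul_comm]
    calc _ ≤ (∑ j, ‖inner ℂ (b j) u‖ * ‖(b j : EuclideanSpace ℂ n) c‖) ^ 2 := by
          gcongr
          refine (norm_sum_le _ _).trans_eq ?_
          simp
      _ ≤ _ := Finset.sum_mul_sq_le_sq_mul_sq _ _ _
  refine (Finset.sum_le_sum fun c _ => hle c).trans ?_
  rw [Finset.sum_comm]
  have hone : ∀ j, ∑ c, ‖(b j : EuclideanSpace ℂ n) c‖ ^ 2 = 1 := by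
    intro j
    rw [← EuclideanSpace.norm_sq_eq]
    have : ‖(b j : EuclideanSpace ℂ n)‖ = 1 := b.orthonormal.1 j
    rw [this, one_pow]
  simp only [hone, Finset.sum_const, Finset.card_univ, Fintype.card_fin, nsmul_eq_mul, mul_one]
  have := LinearMap.finrank_range_le φ
  rw [Module.finrank_fintype_fun_eq_card] at this
  exact_mod_cast this

theorem leverage_submatrix (A : Matrix m n ℂ) (σ : Equiv.Perm n) (c : n) :
    leverage (A.submatrix id σ) c = leverage A (σ c) := by
  unfold leverage
  congr 1
  ext k
  have h : ∀ w : m → ℂ, w ᵥ* A.submatrix id σ = fun c => (w ᵥ* A) (σ c) := fun w => rfl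
  rw [h, euclNorm_sq, euclNorm_sq, Equiv.sum_comp σ (fun c => ‖(_ ᵥ* A) c‖ ^ 2)]

end Leverage

/-! ## The rate in the uplink model -/

namespace Model

variable {Ω : Type*} [MeasurableSpace Ω] {μ : Measure Ω} {M K Nc R : ℕ}
  {T : Finset (UE K Nc)} {P : ℝ}

theorem measMatrix_apply (S : Model μ M K Nc R T P) (ω : Ω) (p : Fin R × Fin M) (l : UE K Nc) :
    S.measMatrix ω p l = S.compression ω p.2 p.1 l.1 * (S.g p.2 l ω * S.h p.2 l ω) := by
  simp [measMatrix, Matrix.mul_apply, channel]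

theorem vecMul_compressionDiag (S : Model μ M K Nc R T P) (ω : Ω) (w : Fin R × Fin M → ℂ)
    (c : Fin Nc) (i : Fin M) :
    (w ᵥ* S.compressionDiag ω) (c, i) = ((fun r => w (r, i)) ᵥ* S.compression ω i) c := by
  simp [Matrix.vecMul, dotProduct, compressionDiag, Matrix.blockDiagonal_apply,
    Fintype.sum_prod_type]

theorem vecMul_measMatrix (S : Model μ M K Nc R T P) (ω : Ω) (w : Fin R × Fin M → ℂ)
    (l : UE K Nc) : (w ᵥ* S.measMatrix ω) l =
      ∑ i, (w ᵥ* S.compressionDiag ω) (l.1, i) * (S.g i l ω * S.h i l ω) := by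
  simp only [vecMul_compressionDiag]
  simp only [Matrix.vecMul, dotProduct, measMatrix_apply, Fintype.sum_prod_type]
  rw [Finset.sum_comm]
  refine Finset.sum_congr rfl fun i _ => ?_
  rw [Finset.sum_mul]
  exact Finset.sum_congr rfl fun r _ => by ring

theorem observed_eq (S : Model μ M K Nc R T P) (ω : Ω) : S.observed ω =
    S.measMatrix ω *ᵥ (fun l => S.x l ω) + S.compressionDiag ω *ᵥ (fun q => S.n q.2 q.1 ω) := by
  ext p
  simp only [observed, received, Matrix.mulVec_add, Pi.add_apply, Matrix.mulVec_mulVec]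
  congr 1
  simp [Matrix.mulVec, dotProduct, compressionDiag, Matrix.blockDiagonal_apply,
    Fintype.sum_prod_type]

theorem norm_compression_sq (S : Model μ M K Nc R T P) (ω : Ω) (i : Fin M) (r : Fin R)
    (c : Fin Nc) : ‖S.compression ω i r c‖ ^ 2 = 1 / (M * R) := by
  simp only [compression, Matrix.of_apply, norm_mul, Complex.norm_real, mul_comm Complex.I,
    Complex.norm_exp_ofReal_mul_I, mul_one]
  rw [Real.norm_of_nonneg (Real.sqrt_nonneg _), Real.sq_sqrt (by positivity)]

theorem sum_norm_compressionDiag_sq (S : Model μ M K Nc R T P) (ω : Ω) (hM : 0 < M) (hR : 0 < R) :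
    ∑ p, ∑ q, ‖S.compressionDiag ω p q‖ ^ 2 = Nc := by
  simp only [compressionDiag, Matrix.blockDiagonal_apply, Fintype.sum_prod_type, apply_ite norm,
    ite_pow, norm_compression_sq]
  simp
  have : (M : ℝ) ≠ 0 := by positivity
  have : (R : ℝ) ≠ 0 := by positivity
  field_simp

/-- Received power of the user `l` after projection on the row spaces of the compression
matrices. -/
noncomputable def capturedPower (S : Model μ M K Nc R T P) (l : UE K Nc) (ω : Ω) : ℝ :=
  ∑ i, S.g i l ω ^ 2 * (‖S.h i l ω‖ ^ 2 * leverage (S.compression ω i) l.1)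

theorem capturedPower_nonneg (S : Model μ M K Nc R T P) (l : UE K Nc) (ω : Ω) :
    0 ≤ S.capturedPower l ω :=
  Finset.sum_nonneg fun _ _ => mul_nonneg (sq_nonneg _)
    (mul_nonneg (sq_nonneg _) (leverage_nonneg _ _))

/-- The unit gain is a sum over heads of an entry of `w A` times `g h`. The leverage score bounds
each entry by the norm of its block, and Cauchy–Schwarz over the heads separates channel from noise.
-/
theorem one_le_capturedPower_mul (S : Model μ M K Nc R T P) (ω : Ω) {w : Fin R × Fin M → ℂ}
    {l : UE K Nc} (hw : (w ᵥ* S.measMatrix ω) l = 1) :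
    1 ≤ S.capturedPower l ω * euclNorm (w ᵥ* S.compressionDiag ω) ^ 2 := by
  set a : Fin M → ℝ := fun i =>
    Real.sqrt (S.g i l ω ^ 2 * (‖S.h i l ω‖ ^ 2 * leverage (S.compression ω i) l.1)) with ha
  set b : Fin M → ℝ := fun i => euclNorm ((fun r => w (r, i)) ᵥ* S.compression ω i) with hb
  have hasq : ∀ i, a i ^ 2 =
      S.g i l ω ^ 2 * (‖S.h i l ω‖ ^ 2 * leverage (S.compression ω i) l.1) := fun i =>
    Real.sq_sqrt (mul_nonneg (sq_nonneg _) (mul_nonneg (sq_nonneg _) (leverage_nonneg _ _)))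
  have hbsum : ∑ i, b i ^ 2 = euclNorm (w ᵥ* S.compressionDiag ω) ^ 2 := by
    rw [euclNorm_sq, Fintype.sum_prod_type, Finset.sum_comm]
    refine Finset.sum_congr rfl fun i _ => ?_
    rw [hb, euclNorm_sq]
    exact Finset.sum_congr rfl fun c _ => by rw [vecMul_compressionDiag]
  have h1 : (1 : ℝ) ≤ ∑ i, a i * b i := by
    calc (1 : ℝ) = ‖(w ᵥ* S.measMatrix ω) l‖ := by rw [hw, norm_one]
      _ ≤ ∑ i, ‖(w ᵥ* S.compressionDiag ω) (l.1, i) * (S.g i l ω * S.h i l ω)‖ := by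
          rw [vecMul_measMatrix]; exact norm_sum_le _ _
      _ ≤ ∑ i, a i * b i := by
          refine Finset.sum_le_sum fun i _ => ?_
          refine abs_le_of_sq_le_sq' ?_
            (mul_nonneg (Real.sqrt_nonneg _) (euclNorm_nonneg _)) |>.2
          rw [mul_pow, hasq, norm_mul, norm_mul, mul_pow, mul_pow, Complex.norm_real,
            Real.norm_eq_abs, sq_abs, vecMul_compressionDiag]
          have := norm_vecMul_sq_le_leverage (S.compression ω i) l.1 (fun r => w (r, i))
          calc _ ≤ (leverage (S.compression ω i) l.1 *
                euclNorm ((fun r => w (r, i)) ᵥ* S.compression ω i) ^ 2) *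
                  (S.g i l ω ^ 2 * ‖S.h i l ω‖ ^ 2) := by gcongr
            _ = _ := by ring
  calc (1 : ℝ) ≤ (∑ i, a i * b i) ^ 2 := one_le_pow₀ h1
    _ ≤ (∑ i, a i ^ 2) * ∑ i, b i ^ 2 := Finset.sum_mul_sq_le_sq_mul_sq _ _ _
    _ = _ := by rw [hbsum, capturedPower, Finset.sum_congr rfl fun i _ => hasq i]

theorem sumRate_le (S : Model μ M K Nc R T P) (hP : 0 ≤ P) (ω : Ω) (That : Finset (UE K Nc)) :
    sumRate (S.measMatrix ω) (S.compressionDiag ω) P T That ≤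
      ∑ l ∈ T, Real.log (1 + P * S.capturedPower l ω) := by
  have hpos : ∀ l, 0 ≤ Real.log (1 + P * S.capturedPower l ω) := fun l =>
    Real.log_nonneg (le_add_of_nonneg_right (mul_nonneg hP (S.capturedPower_nonneg l ω)))
  unfold sumRate
  split_ifs with hU
  · calc _ ≤ ∑ l : That, (if (l : UE K Nc) ∈ T then
          Real.log (1 + P * S.capturedPower l ω) else 0) := by
          refine Finset.sum_le_sum fun l _ => ?_
          split_ifs with hl
          · have h1 := S.one_le_capturedPower_mul ω (pinv_row_vecMul_eq_one hU l)
            have h2 := le_covariance_diag_re (S.measMatrix ω) (S.compressionDiag ω) hP T That l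
            have hX := S.capturedPower_nonneg l ω
            set α := (covariance (S.measMatrix ω) (S.compressionDiag ω) P T That l l).re
            have h3 : 1 ≤ S.capturedPower l ω * α := h1.trans (by gcongr)
            have hα : 0 < α := by
              by_contra hc
              push Not at hc
              nlinarith
            have h4 : P / α ≤ P * S.capturedPower l ω := by
              rw [div_le_iff₀ hα]
              nlinarith
            exact Real.log_le_log (by positivity) (by linarith)
          · simp
      _ = ∑ l ∈ That, (if l ∈ T then Real.log (1 + P * S.capturedPower l ω) else 0) :=
          Finset.sum_coe_sort That fun l =>
            if l ∈ T then Real.log (1 + P * S.capturedPower l ω) else 0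
      _ = ∑ l ∈ That.filter (· ∈ T), Real.log (1 + P * S.capturedPower l ω) :=
          (Finset.sum_filter _ _).symm
      _ ≤ _ := Finset.sum_le_sum_of_subset_of_nonneg
          (fun l hl => (Finset.mem_filter.1 hl).2) fun l _ _ => hpos l
  · exact Finset.sum_nonneg fun l _ => hpos l

theorem le_sumRate_self (S : Model μ M K Nc R T P) (hM : 0 < M) (hR : 0 < R) (hNc : 0 < Nc)
    (hP : 0 ≤ P) (ω : Ω) {κ : ℝ}
    (hκ : 0 < κ) (h : BoundedBelowOn (S.measMatrix ω) T κ) :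
    T.card * Real.log (1 + P / (Nc / κ ^ 2)) ≤
      sumRate (S.measMatrix ω) (S.compressionDiag ω) P T T := by
  have hU := h.isUnit_gram hκ
  rw [sumRate, if_pos hU]
  calc _ = ∑ l : T, Real.log (1 + P / (Nc / κ ^ 2)) := by simp
    _ ≤ _ := Finset.sum_le_sum fun l _ => ?_
  rw [if_pos l.2, covariance_self_diag_re]
  set w := pinv (cols (S.measMatrix ω) T) l with hw
  have h1 := S.one_le_capturedPower_mul ω (pinv_row_vecMul_eq_one hU l)
  -- Needed because `P / 0 = 0`: zero noise power would give rate 0 instead of a large one.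
  have hpos : 0 < euclNorm (w ᵥ* S.compressionDiag ω) ^ 2 := by
    by_contra hc
    push Not at hc
    have := S.capturedPower_nonneg l ω
    nlinarith
  have h2 : euclNorm (w ᵥ* S.compressionDiag ω) ^ 2 ≤ Nc / κ ^ 2 := by
    rw [← Matrix.mulVec_transpose]
    refine (euclNorm_mulVec_sq_le _ _).trans ?_
    simp only [Matrix.transpose_apply]
    rw [Finset.sum_comm, S.sum_norm_compressionDiag_sq ω hM hR, div_eq_mul_inv, ← inv_pow]
    have := h.euclNorm_pinv_row_le hκ l
    have := euclNorm_nonneg w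
    gcongr
  gcongr

end Model

/-! ## Measurability -/

section Measurability

variable {Ω : Type*} [MeasurableSpace Ω] {m n r ι : Type*}

theorem measurable_comp_countable {β : Type*} [MeasurableSpace β] [Countable β]
    [MeasurableSingletonClass β] {f : Ω → β → ℝ} (hf : ∀ b, Measurable fun ω => f ω b) {g : Ω → β}
    (hg : Measurable g) : Measurable fun ω => f ω (g ω) :=
  (measurable_from_prod_countable_left (f := fun p : Ω × β => f p.1 p.2) hf).comp
    (measurable_id.prodMk hg)

theorem measurable_mul_entries [Fintype n] {A : Ω → Matrix m n ℂ} {B : Ω → Matrix n r ℂ}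
    (hA : ∀ i j, Measurable fun ω => A ω i j) (hB : ∀ i j, Measurable fun ω => B ω i j) (i : m)
    (j : r) : Measurable fun ω => (A ω * B ω) i j := by
  simp only [Matrix.mul_apply]
  exact Finset.measurable_fun_sum _ fun k _ => (hA i k).mul (hB k j)

theorem measurable_conjTranspose_entries {A : Ω → Matrix m n ℂ}
    (hA : ∀ i j, Measurable fun ω => A ω i j) (i : n) (j : m) :
    Measurable fun ω => (A ω)ᴴ i j := by
  simp only [Matrix.conjTranspose_apply, RCLike.star_def]
  exact Complex.continuous_conj.measurable.comp (hA j i)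

theorem measurable_det_of_entries [Fintype n] [DecidableEq n] {A : Ω → Matrix n n ℂ}
    (hA : ∀ i j, Measurable fun ω => A ω i j) : Measurable fun ω => (A ω).det := by
  simp only [Matrix.det_apply']
  exact Finset.measurable_fun_sum _ fun σ _ =>
    measurable_const.mul (Finset.measurable_fun_prod _ fun i _ => hA _ _)

theorem measurable_inv_entries [Fintype n] [DecidableEq n] {A : Ω → Matrix n n ℂ}
    (hA : ∀ i j, Measurable fun ω => A ω i j) (i j : n) :
    Measurable fun ω => (A ω)⁻¹ i j := by
  simp only [Matrix.inv_def, Matrix.smul_apply, Ring.inverse_eq_inv', smul_eq_mul,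
    Matrix.adjugate_apply]
  refine (measurable_det_of_entries hA).inv.mul (measurable_det_of_entries fun k l => ?_)
  by_cases hk : k = j
  · subst hk
    simp
  · simp only [Matrix.updateRow_ne hk]
    exact hA k l

theorem measurable_euclNorm [Fintype n] {v : Ω → n → ℂ} (hv : ∀ i, Measurable fun ω => v ω i) :
    Measurable fun ω => euclNorm (v ω) := by
  simp only [euclNorm, EuclideanSpace.norm_eq]
  exact (Finset.measurable_fun_sum _ fun i _ => (hv i).norm.pow_const 2).sqrt

theorem measurable_leverage [Fintype m] [Fintype n] {A : Ω → Matrix m n ℂ}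
    (hA : ∀ i j, Measurable fun ω => A ω i j) (c : n) : Measurable fun ω => leverage (A ω) c := by
  unfold leverage
  refine Measurable.iSup fun k => ?_
  have h : ∀ j, Measurable fun ω => (TopologicalSpace.denseSeq (m → ℂ) k ᵥ* A ω) j := fun j => by
    simp only [Matrix.vecMul, dotProduct]
    exact Finset.measurable_fun_sum _ fun i _ => (hA i j).const_mul _
  exact ((h c).norm.pow_const 2).div ((measurable_euclNorm h).pow_const 2)

/-- The rate is 0 unless the Gram matrix is invertible, and there the pseudoinverse is `(Bᴴ B)⁻¹
Bᴴ`, whose entries are measurable by Cramer's rule. Measurability of `pinv` itself is never needed.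
-/
theorem measurable_sumRate [Fintype m] [Fintype n] [DecidableEq ι] {Θ : Ω → Matrix m ι ℂ}
    {A : Ω → Matrix m n ℂ} (hΘ : ∀ i j, Measurable fun ω => Θ ω i j)
    (hA : ∀ i j, Measurable fun ω => A ω i j) (P : ℝ) (T That : Finset ι) :
    Measurable fun ω => sumRate (Θ ω) (A ω) P T That := by
  have hcols : ∀ (S : Finset ι) i j, Measurable fun ω => cols (Θ ω) S i j := fun S i j => hΘ i j
  have hG := measurable_mul_entries (measurable_conjTranspose_entries (hcols That)) (hcols That)
  have hW := measurable_mul_entries (measurable_inv_entries hG)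
    (measurable_conjTranspose_entries (hcols That))
  have hN : ∀ i j, Measurable fun ω => ((P : ℂ) • (cols (Θ ω) (T \ That) *
      (cols (Θ ω) (T \ That))ᴴ) + A ω * (A ω)ᴴ) i j := fun i j => by
    simp only [Matrix.add_apply, Matrix.smul_apply, smul_eq_mul]
    exact ((measurable_mul_entries (hcols _)
      (measurable_conjTranspose_entries (hcols _)) i j).const_mul (P : ℂ)).add
        (measurable_mul_entries hA (measurable_conjTranspose_entries hA) i j)
  have hC := measurable_mul_entries (measurable_mul_entries hW hN)
    (measurable_conjTranspose_entries hW)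
  have hset : MeasurableSet {ω | IsUnit ((cols (Θ ω) That)ᴴ * cols (Θ ω) That)} := by
    simp only [Matrix.isUnit_iff_isUnit_det, isUnit_iff_ne_zero]
    exact (measurable_det_of_entries hG) (measurableSet_singleton 0).compl
  unfold sumRate
  classical
  have hsum : Measurable fun ω => ∑ l : That, Real.log (1 + (if (l : ι) ∈ T then P else 0) /
      (((((cols (Θ ω) That)ᴴ * cols (Θ ω) That)⁻¹ * (cols (Θ ω) That)ᴴ) *
        ((P : ℂ) • (cols (Θ ω) (T \ That) * (cols (Θ ω) (T \ That))ᴴ) + A ω * (A ω)ᴴ) *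
        (((cols (Θ ω) That)ᴴ * cols (Θ ω) That)⁻¹ * (cols (Θ ω) That)ᴴ)ᴴ) l l).re) :=
    Finset.measurable_fun_sum _ fun l _ => Real.measurable_log.comp
      (measurable_const.add (measurable_const.div (Complex.measurable_re.comp (hC l l))))
  convert hsum.indicator hset using 1
  funext ω
  by_cases hU : IsUnit ((cols (Θ ω) That)ᴴ * cols (Θ ω) That)
  · rw [if_pos hU, Set.indicator_of_mem (by exact hU)]
    simp only [covariance, (pinv_spec (cols (Θ ω) That)).2.2.2.2 hU]
  · rw [if_neg hU, Set.indicator_of_notMem (by exact hU)]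

/-- For fixed `v` the inequalities are closed in the matrix, so the uncountable intersection over
`v` is closed. -/
theorem measurableSet_rip [Fintype m] [Fintype ι] {B : Ω → Matrix m ι ℂ}
    (hB : ∀ i j, Measurable fun ω => B ω i j) (k : ℕ) (δ : ℝ) :
    MeasurableSet {ω | RIP (B ω) k δ} := by
  by_cases hδ : 0 ≤ δ ∧ δ < 1
  · have hcont : ∀ v : ι → ℂ, Continuous fun B : m → ι → ℂ => euclNorm (Matrix.of B *ᵥ v) ^ 2 := by
      intro v
      simp only [euclNorm_sq, Matrix.mulVec, dotProduct, Matrix.of_apply]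
      fun_prop
    have hcl : IsClosed {B : m → ι → ℂ | ∀ v : ι → ℂ,
        (Finset.univ.filter fun l => v l ≠ 0).card ≤ k →
          (1 - δ) * euclNorm v ^ 2 ≤ euclNorm (Matrix.of B *ᵥ v) ^ 2 ∧
            euclNorm (Matrix.of B *ᵥ v) ^ 2 ≤ (1 + δ) * euclNorm v ^ 2} := by
      simp only [Set.ofPred_forall]
      exact isClosed_iInter fun v => isClosed_iInter fun _ =>
        (isClosed_le continuous_const (hcont v)).inter (isClosed_le (hcont v) continuous_const)
    have hmeas : Measurable fun ω => (fun i j => B ω i j : m → ι → ℂ) :=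
      measurable_pi_lambda _ fun i => measurable_pi_lambda _ fun j => hB i j
    convert hmeas hcl.measurableSet using 1
    ext ω
    simp only [RIP, hδ, true_and, Set.mem_ofPred_eq, Set.mem_preimage]
    rfl
  · convert MeasurableSet.empty
    refine Set.eq_empty_of_forall_notMem fun ω h => hδ ⟨h.1, h.2.1⟩

end Measurability

/-- The compression matrix with phases `θ`. -/
noncomputable def phaseMatrix (M : ℕ) {R Nc : ℕ} (θ : Fin R → Fin Nc → ℝ) :
    Matrix (Fin R) (Fin Nc) ℂ :=
  Matrix.of fun r c => (Real.sqrt (1 / (M * R)) : ℂ) * Complex.exp (Complex.I * (θ r c : ℂ))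

/-- The measurement matrix with fading coefficients `g`, `h` and phases `θ`. -/
noncomputable def fadingMatrix {M K Nc R : ℕ} (g : Fin M → UE K Nc → ℝ) (h : Fin M → UE K Nc → ℂ)
    (θ : Fin M → Fin R → Fin Nc → ℝ) : Matrix (Fin R × Fin M) (UE K Nc) ℂ :=
  Matrix.of fun p l => phaseMatrix M (θ p.2) p.1 l.1 * (g p.2 l * h p.2 l)

theorem measurable_phaseMatrix {M R Nc : ℕ} (r : Fin R) (c : Fin Nc) :
    Measurable fun θ : Fin R → Fin Nc → ℝ => phaseMatrix M θ r c := by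
  unfold phaseMatrix
  simp only [Matrix.of_apply]
  fun_prop

/-- Turns a rescaling of the measurement matrix into a rescaling of the Gaussian fading, whose law
can be compared. -/
theorem fadingMatrix_smul {M K Nc R : ℕ} (t : ℂ) (g : Fin M → UE K Nc → ℝ)
    (h : Fin M → UE K Nc → ℂ) (θ : Fin M → Fin R → Fin Nc → ℝ) :
    fadingMatrix g (t • h) θ = t • fadingMatrix g h θ := by
  ext p l
  simp only [fadingMatrix, Matrix.of_apply, Pi.smul_apply, Matrix.smul_apply, smul_eq_mul]
  ring

/-! ### Measurability of the random model. -/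

namespace Model

variable {Ω : Type*} [MeasurableSpace Ω] {μ : Measure Ω} {M K Nc R : ℕ}
  {T : Finset (UE K Nc)} {P : ℝ}

theorem compression_eq (S : Model μ M K Nc R T P) (ω : Ω) (i : Fin M) :
    S.compression ω i = phaseMatrix M (fun r c => S.θ i r c ω) := rfl

theorem measMatrix_eq (S : Model μ M K Nc R T P) (ω : Ω) : S.measMatrix ω =
    fadingMatrix (fun i l => S.g i l ω) (fun i l => S.h i l ω) (fun i r c => S.θ i r c ω) := by
  ext p l
  rw [measMatrix_apply, compression_eq]
  rfl

theorem measurable_fading (S : Model μ M K Nc R T P) :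
    Measurable fun ω => (fun i l => S.g i l ω : Fin M → UE K Nc → ℝ) :=
  measurable_pi_lambda _ fun i => measurable_pi_lambda _ fun l => S.measurable_g i l

theorem measurable_smallFading (S : Model μ M K Nc R T P) :
    Measurable fun ω => (fun i l => S.h i l ω : Fin M → UE K Nc → ℂ) :=
  measurable_pi_lambda _ fun i => measurable_pi_lambda _ fun l => S.measurable_h i l

theorem measurable_phases (S : Model μ M K Nc R T P) :
    Measurable fun ω => (fun i r c => S.θ i r c ω : Fin M → Fin R → Fin Nc → ℝ) :=
  measurable_pi_lambda _ fun i => measurable_pi_lambda _ fun r => measurable_pi_lambda _ fun c =>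
    S.measurable_θ i r c

theorem measurable_symbols (S : Model μ M K Nc R T P) :
    Measurable fun ω => (fun l => S.x l ω : UE K Nc → ℂ) :=
  measurable_pi_lambda _ fun l => S.measurable_x l

theorem measurable_noise (S : Model μ M K Nc R T P) :
    Measurable fun ω => (fun i c => S.n i c ω : Fin M → Fin Nc → ℂ) :=
  measurable_pi_lambda _ fun i => measurable_pi_lambda _ fun c => S.measurable_n i c

theorem measurable_compression (S : Model μ M K Nc R T P) (i : Fin M) (r : Fin R) (c : Fin Nc) :
    Measurable fun ω => S.compression ω i r c :=
  (measurable_phaseMatrix r c).comp ((measurable_pi_apply i).comp S.measurable_phases)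

theorem measurable_compressionDiag (S : Model μ M K Nc R T P) (p : Fin R × Fin M)
    (q : Fin Nc × Fin M) : Measurable fun ω => S.compressionDiag ω p q := by
  simp only [compressionDiag, Matrix.blockDiagonal_apply]
  split_ifs
  · exact S.measurable_compression _ _ _
  · exact measurable_const

theorem measurable_measMatrix (S : Model μ M K Nc R T P) (p : Fin R × Fin M) (l : UE K Nc) :
    Measurable fun ω => S.measMatrix ω p l := by
  simp only [measMatrix_apply]
  exact (S.measurable_compression _ _ _).mul
    ((Complex.measurable_ofReal.comp (S.measurable_g _ _)).mul (S.measurable_h _ _))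

theorem measurable_sumRate (S : Model μ M K Nc R T P) {That : Ω → Finset (UE K Nc)}
    (hT : Measurable That) :
    Measurable fun ω => sumRate (S.measMatrix ω) (S.compressionDiag ω) P T (That ω) := by
  have h : ∀ U, Measurable fun ω =>
      sumRate (S.measMatrix ω) (S.compressionDiag ω) P T U := fun U =>
    CRAN.measurable_sumRate S.measurable_measMatrix S.measurable_compressionDiag P T U
  exact measurable_comp_countable h hT

end Model

/-! ## Complex Gaussian variables -/

section Gaussian

theorem measurable_ofReal_add_mul_I :
    Measurable fun p : ℝ × ℝ => (p.1 : ℂ) + (p.2 : ℂ) * Complex.I := by fun_prop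

instance isProbabilityMeasure_complexGaussian (v : ℝ) : IsProbabilityMeasure (complexGaussian v) :=
  Measure.isProbabilityMeasure_map measurable_ofReal_add_mul_I.aemeasurable

theorem norm_ofReal_add_mul_I_sq (x y : ℝ) :
    ‖(x : ℂ) + (y : ℂ) * Complex.I‖ ^ 2 = x ^ 2 + y ^ 2 := by
  rw [← Complex.normSq_eq_norm_sq, Complex.normSq_add_mul_I]

theorem integrable_sq_gaussianReal (v : NNReal) :
    Integrable (fun x : ℝ => x ^ 2) (gaussianReal 0 v) :=
  (memLp_id_gaussianReal 2).integrable_sq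

theorem integral_sq_gaussianReal (v : NNReal) : ∫ x, x ^ 2 ∂gaussianReal 0 v = v := by
  rw [← variance_fun_id_gaussianReal (μ := 0) (v := v),
    variance_of_integral_eq_zero aemeasurable_id' integral_id_gaussianReal]

theorem integrable_norm_sq_complexGaussian (v : ℝ) :
    Integrable (fun z : ℂ => ‖z‖ ^ 2) (complexGaussian v) := by
  rw [complexGaussian, integrable_map_measure (by fun_prop) (by fun_prop)]
  simp only [Function.comp_def, norm_ofReal_add_mul_I_sq]
  exact ((integrable_sq_gaussianReal _).comp_fst _).add ((integrable_sq_gaussianReal _).comp_snd _)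

theorem integral_norm_sq_complexGaussian {v : ℝ} (hv : 0 ≤ v) :
    ∫ z, ‖z‖ ^ 2 ∂complexGaussian v = v := by
  rw [complexGaussian, integral_map (by fun_prop) (by fun_prop)]
  simp only [norm_ofReal_add_mul_I_sq]
  rw [integral_add ((integrable_sq_gaussianReal _).comp_fst _)
    ((integrable_sq_gaussianReal _).comp_snd _), integral_fun_fst (fun x : ℝ => x ^ 2),
    integral_fun_snd (fun x : ℝ => x ^ 2), integral_sq_gaussianReal]
  simp
  rw [max_eq_left (by positivity)]
  ring

end Gaussian

/-! ## The upper bound on the rate -/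

/-- Tangent line of the concave logarithm at `a`; integrating it replaces Jensen's inequality. -/
theorem log_one_add_le {a y : ℝ} (ha : 0 ≤ a) (hy : 0 ≤ y) :
    Real.log (1 + y) ≤ Real.log (1 + a) + (y - a) / (1 + a) := by
  have h := Real.log_le_sub_one_of_pos (show 0 < (1 + y) / (1 + a) by positivity)
  rw [Real.log_div (by positivity) (by positivity)] at h
  have : (y - a) / (1 + a) = (1 + y) / (1 + a) - 1 := by field_simp; ring
  linarith

namespace Model

variable {Ω : Type*} [MeasurableSpace Ω] {μ : Measure Ω} {M K Nc R : ℕ}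
  {T : Finset (UE K Nc)} {P : ℝ}

theorem integrable_norm_sq_h [IsProbabilityMeasure μ] (S : Model μ M K Nc R T P) (i : Fin M)
    (l : UE K Nc) : Integrable (fun ω => ‖S.h i l ω‖ ^ 2) μ := by
  have h := integrable_norm_sq_complexGaussian 1
  rw [← S.h_law i l] at h
  exact h.comp_measurable (S.measurable_h i l)

theorem integral_norm_sq_h [IsProbabilityMeasure μ] (S : Model μ M K Nc R T P) (i : Fin M)
    (l : UE K Nc) : ∫ ω, ‖S.h i l ω‖ ^ 2 ∂μ = 1 := by
  rw [← integral_norm_sq_complexGaussian zero_le_one, ← S.h_law i l,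
    integral_map (S.measurable_h i l).aemeasurable (by fun_prop)]

theorem integrable_g_sq [IsProbabilityMeasure μ] (S : Model μ M K Nc R T P) (i : Fin M)
    (l : UE K Nc) : Integrable (fun ω => S.g i l ω ^ 2) μ := by
  refine Integrable.of_bound ((S.measurable_g i l).pow_const 2).aestronglyMeasurable (M : ℝ) ?_
  filter_upwards [S.g_normalized l] with ω hω
  rw [Real.norm_of_nonneg (sq_nonneg _), ← hω]
  exact Finset.single_le_sum (f := fun i => S.g i l ω ^ 2) (fun i _ => sq_nonneg _)
    (Finset.mem_univ i)

theorem measurable_leverage_compression (S : Model μ M K Nc R T P) (i : Fin M) (c : Fin Nc) :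
    Measurable fun ω => leverage (S.compression ω i) c :=
  measurable_leverage (fun r c => S.measurable_compression i r c) c

theorem integrable_leverage [IsProbabilityMeasure μ] (S : Model μ M K Nc R T P) (i : Fin M)
    (c : Fin Nc) : Integrable (fun ω => leverage (S.compression ω i) c) μ := by
  refine Integrable.of_bound (S.measurable_leverage_compression i c).aestronglyMeasurable 1 ?_
  refine Filter.Eventually.of_forall fun ω => ?_
  rw [Real.norm_of_nonneg (leverage_nonneg _ _)]
  exact leverage_le_one _ _

theorem map_phases_perm [IsProbabilityMeasure μ] (S : Model μ M K Nc R T P) (i : Fin M)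
    (σ : Equiv.Perm (Fin Nc)) :
    μ.map (fun ω (p : Fin R × Fin Nc) => S.θ i p.1 (σ p.2) ω) =
      Measure.pi fun _ => cond volume (Set.Ico 0 (2 * Real.pi)) := by
  have hinj : Function.Injective
      fun p : Fin R × Fin Nc => ((i, p.1, σ p.2) : Fin M × Fin R × Fin Nc) := by
    rintro ⟨r, c⟩ ⟨r', c'⟩ h
    simp only [Prod.mk.injEq, true_and, EmbeddingLike.apply_eq_iff_eq] at h
    rw [h.1, h.2]
  rw [(iIndepFun_iff_map_fun_eq_pi_map fun p : Fin R × Fin Nc =>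
    (S.measurable_θ i p.1 (σ p.2)).aemeasurable).1 (S.θ_indep.precomp hinj)]
  congr 1
  funext p
  exact S.θ_law _ _ _

/-- The phases are i.i.d., so permuting the columns of a compression matrix does not change its law.
-/
theorem integral_leverage_perm [IsProbabilityMeasure μ] (S : Model μ M K Nc R T P) (i : Fin M)
    (σ : Equiv.Perm (Fin Nc)) (c : Fin Nc) :
    ∫ ω, leverage (S.compression ω i) (σ c) ∂μ = ∫ ω, leverage (S.compression ω i) c ∂μ := by
  set Φ : (Fin R × Fin Nc → ℝ) → ℝ := fun f => leverage (phaseMatrix M fun r c => f (r, c)) c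
    with hΦ
  have hΦm : Measurable Φ := measurable_leverage (fun r c =>
    (measurable_phaseMatrix r c).comp (measurable_pi_lambda _ fun r =>
      measurable_pi_lambda _ fun c => measurable_pi_apply (r, c))) c
  have key : ∀ τ : Equiv.Perm (Fin Nc), ∫ ω, leverage (S.compression ω i) (τ c) ∂μ =
      ∫ f, Φ f ∂(Measure.pi fun _ : Fin R × Fin Nc =>
        cond volume (Set.Ico 0 (2 * Real.pi))) := by
    intro τ
    rw [← S.map_phases_perm i τ, integral_map
      (measurable_pi_lambda _ fun p => S.measurable_θ i p.1 (τ p.2)).aemeasurable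
      hΦm.aestronglyMeasurable]
    refine integral_congr_ae (Filter.Eventually.of_forall fun ω => ?_)
    simp only [hΦ]
    rw [← leverage_submatrix]
    rfl
  rw [key σ, ← key (Equiv.refl _)]
  rfl

theorem integral_leverage_le [IsProbabilityMeasure μ] (S : Model μ M K Nc R T P) (i : Fin M)
    (c : Fin Nc) : ∫ ω, leverage (S.compression ω i) c ∂μ ≤ (R : ℝ) / Nc := by
  have hNc : (0 : ℝ) < Nc := by exact_mod_cast (Fin.pos c)
  have hall : ∀ c', ∫ ω, leverage (S.compression ω i) c' ∂μ =
      ∫ ω, leverage (S.compression ω i) c ∂μ := by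
    intro c'
    have := S.integral_leverage_perm i (Equiv.swap c c') c
    rwa [Equiv.swap_apply_left] at this
  have hsum : ∑ c', ∫ ω, leverage (S.compression ω i) c' ∂μ ≤ R := by
    rw [← integral_finsetSum _ fun c' _ => S.integrable_leverage i c']
    calc _ ≤ ∫ _, (R : ℝ) ∂μ := by
          refine integral_mono (integrable_finsetSum _ fun c' _ => S.integrable_leverage i c')
            (integrable_const _) fun ω => ?_
          simpa using sum_leverage_le (S.compression ω i)
      _ = R := by simp
  simp only [hall, Finset.sum_const, Finset.card_univ, Fintype.card_fin, nsmul_eq_mul] at hsum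
  rw [le_div_iff₀ hNc]
  linarith

theorem indepFun_norm_sq_h_leverage (S : Model μ M K Nc R T P) (i : Fin M) (l : UE K Nc) :
    IndepFun (fun ω => ‖S.h i l ω‖ ^ 2) (fun ω => leverage (S.compression ω i) l.1) μ := by
  have hφ : Measurable fun h : Fin M → UE K Nc → ℂ => ‖h i l‖ ^ 2 := by fun_prop
  have hψ : Measurable fun w : (Fin M → Fin R → Fin Nc → ℝ) × (UE K Nc → ℂ) ×
      (Fin M → Fin Nc → ℂ) => leverage (phaseMatrix M (w.1 i)) l.1 :=
    measurable_leverage (fun r c => (measurable_phaseMatrix r c).comp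
      ((measurable_pi_apply i).comp measurable_fst)) l.1
  exact S.indep_h.comp hφ hψ

theorem indepFun_g_sq (S : Model μ M K Nc R T P) (i : Fin M) (l : UE K Nc) :
    IndepFun (fun ω => S.g i l ω ^ 2)
      (fun ω => ‖S.h i l ω‖ ^ 2 * leverage (S.compression ω i) l.1) μ := by
  have hφ : Measurable fun g : Fin M → UE K Nc → ℝ => g i l ^ 2 := by fun_prop
  have hψ : Measurable fun w : (Fin M → UE K Nc → ℂ) × (Fin M → Fin R → Fin Nc → ℝ) ×
      (UE K Nc → ℂ) × (Fin M → Fin Nc → ℂ) =>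
        ‖w.1 i l‖ ^ 2 * leverage (phaseMatrix M (w.2.1 i)) l.1 := by
    refine Measurable.mul (by fun_prop) ?_
    exact measurable_leverage (fun r c => (measurable_phaseMatrix r c).comp
      ((measurable_pi_apply i).comp (measurable_fst.comp measurable_snd))) l.1
  exact S.indep_g.comp hφ hψ

theorem integrable_capturedPower_term [IsProbabilityMeasure μ] (S : Model μ M K Nc R T P)
    (i : Fin M) (l : UE K Nc) : Integrable (fun ω =>
      S.g i l ω ^ 2 * (‖S.h i l ω‖ ^ 2 * leverage (S.compression ω i) l.1)) μ :=
  (S.indepFun_g_sq i l).integrable_mul (S.integrable_g_sq i l)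
    ((S.indepFun_norm_sq_h_leverage i l).integrable_mul (S.integrable_norm_sq_h i l)
      (S.integrable_leverage i l.1))

theorem integrable_capturedPower [IsProbabilityMeasure μ] (S : Model μ M K Nc R T P)
    (l : UE K Nc) : Integrable (S.capturedPower l) μ :=
  integrable_finsetSum _ fun i _ => S.integrable_capturedPower_term i l

theorem integral_capturedPower_le [IsProbabilityMeasure μ] (S : Model μ M K Nc R T P)
    (l : UE K Nc) : ∫ ω, S.capturedPower l ω ∂μ ≤ M * ((R : ℝ) / Nc) := by
  unfold capturedPower
  rw [integral_finsetSum _ fun i _ => S.integrable_capturedPower_term i l]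
  calc _ ≤ ∑ _i : Fin M, (R : ℝ) / Nc := by
        refine Finset.sum_le_sum fun i _ => ?_
        rw [(S.indepFun_g_sq i l).integral_fun_mul_eq_mul_integral
          (S.integrable_g_sq i l).aestronglyMeasurable
          ((S.measurable_h i l).norm.pow_const 2 |>.mul
            (S.measurable_leverage_compression i l.1)).aestronglyMeasurable,
          (S.indepFun_norm_sq_h_leverage i l).integral_fun_mul_eq_mul_integral
          (S.integrable_norm_sq_h i l).aestronglyMeasurable
          (S.integrable_leverage i l.1).aestronglyMeasurable, S.g_secondMoment,
          S.integral_norm_sq_h, one_mul, one_mul]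
        exact S.integral_leverage_le i l.1
    _ = _ := by simp

theorem integrable_sumRate [IsProbabilityMeasure μ] (S : Model μ M K Nc R T P) (hP : 0 ≤ P)
    {That : Ω → Finset (UE K Nc)} (hT : Measurable That) :
    Integrable (fun ω => sumRate (S.measMatrix ω) (S.compressionDiag ω) P T (That ω)) μ := by
  refine Integrable.mono' (g := fun ω => ∑ l ∈ T, P * S.capturedPower l ω)
    (integrable_finsetSum _ fun l _ => (S.integrable_capturedPower l).const_mul P)
    (S.measurable_sumRate hT).aestronglyMeasurable (Filter.Eventually.of_forall fun ω => ?_)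
  rw [Real.norm_of_nonneg (sumRate_nonneg _ _ hP _ _)]
  refine (S.sumRate_le hP ω (That ω)).trans (Finset.sum_le_sum fun l _ => ?_)
  have h := mul_nonneg hP (S.capturedPower_nonneg l ω)
  have := Real.log_le_sub_one_of_pos (show 0 < 1 + P * S.capturedPower l ω by linarith)
  linarith

theorem integral_sumRate_le [IsProbabilityMeasure μ] (S : Model μ M K Nc R T P) (hP : 0 ≤ P)
    {That : Ω → Finset (UE K Nc)} (hT : Measurable That) :
    ∫ ω, sumRate (S.measMatrix ω) (S.compressionDiag ω) P T (That ω) ∂μ ≤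
      T.card * Real.log (1 + M * ((R : ℝ) / Nc) * P) := by
  set a : ℝ := M * ((R : ℝ) / Nc) * P with ha
  have ha0 : 0 ≤ a := by positivity
  have hsub : ∀ l, Integrable (fun ω => P * S.capturedPower l ω - a) μ := fun l =>
    ((S.integrable_capturedPower l).const_mul P).sub (integrable_const _)
  have hint : ∀ l, Integrable (fun ω => Real.log (1 + a) +
      (P * S.capturedPower l ω - a) / (1 + a)) μ := fun l =>
    (integrable_const _).add ((hsub l).div_const _)
  calc _ ≤ ∫ ω, ∑ l ∈ T, (Real.log (1 + a) + (P * S.capturedPower l ω - a) / (1 + a)) ∂μ := by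
        refine integral_mono (S.integrable_sumRate hP hT)
          (integrable_finsetSum _ fun l _ => hint l) fun ω => ?_
        exact (S.sumRate_le hP ω (That ω)).trans (Finset.sum_le_sum fun l _ =>
          log_one_add_le ha0 (mul_nonneg hP (S.capturedPower_nonneg l ω)))
    _ = ∑ l ∈ T, ∫ ω, (Real.log (1 + a) + (P * S.capturedPower l ω - a) / (1 + a)) ∂μ :=
        integral_finsetSum _ fun l _ => hint l
    _ ≤ ∑ l ∈ T, Real.log (1 + a) := by
        refine Finset.sum_le_sum fun l _ => ?_
        rw [integral_add (integrable_const _) ((hsub l).div_const _),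
          integral_div, integral_sub ((S.integrable_capturedPower l).const_mul P)
          (integrable_const _), integral_const_mul]
        simp only [integral_const, probReal_univ, one_smul]
        have h1 := mul_le_mul_of_nonneg_left (S.integral_capturedPower_le l) hP
        have h2 : (P * ∫ ω, S.capturedPower l ω ∂μ - a) / (1 + a) ≤ 0 :=
          div_nonpos_of_nonpos_of_nonneg (by linarith) (by linarith)
        linarith
    _ = _ := by simp

end Model

/-! ## Gaussian tail estimates and scaling -/

section Scaling

theorem gaussianPDFReal_zero_le (v : NNReal) (x : ℝ) :
    gaussianPDFReal 0 v x ≤ (Real.sqrt (2 * Real.pi * v))⁻¹ := by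
  rw [gaussianPDFReal_def]
  refine mul_le_of_le_one_right (by positivity) (Real.exp_le_one_iff.2 ?_)
  have : 0 ≤ (x - 0) ^ 2 / (2 * v) := by positivity
  rw [neg_div]
  linarith

theorem gaussianReal_Icc_le {v : NNReal} (hv : v ≠ 0) (ρ : ℝ) :
    gaussianReal 0 v (Set.Icc (-ρ) ρ) ≤
      ENNReal.ofReal (2 * ρ / Real.sqrt (2 * Real.pi * v)) := by
  rw [gaussianReal_apply _ hv]
  calc ∫⁻ x in Set.Icc (-ρ) ρ, gaussianPDF 0 v x
      ≤ ∫⁻ _ in Set.Icc (-ρ) ρ, ENNReal.ofReal (Real.sqrt (2 * Real.pi * v))⁻¹ :=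
        lintegral_mono fun x => ENNReal.ofReal_le_ofReal (gaussianPDFReal_zero_le v x)
    _ = _ := by
        rw [setLIntegral_const, Real.volume_Icc, ← ENNReal.ofReal_mul (by positivity)]
        congr 1
        ring

/-- Only the real part is used. The linear rate `ρ / √P` is enough because `ρ` will grow like
`P^(1/4)`. -/
theorem complexGaussian_ball_le {P : ℝ} (hP : 0 < P) (ρ : ℝ) :
    complexGaussian P {z | ‖z‖ ≤ ρ} ≤ ENNReal.ofReal (2 * ρ / Real.sqrt (Real.pi * P)) := by
  have hv : (P / 2).toNNReal ≠ 0 := (Real.toNNReal_pos.2 (by positivity)).ne'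
  have hm : MeasurableSet {z : ℂ | ‖z‖ ≤ ρ} := measurableSet_le measurable_norm measurable_const
  rw [complexGaussian, Measure.map_apply measurable_ofReal_add_mul_I hm]
  calc _ ≤ ((gaussianReal 0 (P / 2).toNNReal).prod (gaussianReal 0 (P / 2).toNNReal))
        (Set.Icc (-ρ) ρ ×ˢ Set.univ) := by
        refine measure_mono fun p hp => ?_
        have h1 := Complex.abs_re_le_norm ((p.1 : ℂ) + (p.2 : ℂ) * Complex.I)
        have h2 : ‖(p.1 : ℂ) + (p.2 : ℂ) * Complex.I‖ ≤ ρ := hp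
        simp only [Complex.add_re, Complex.ofReal_re, Complex.mul_re, Complex.I_re, mul_zero,
          Complex.ofReal_im, Complex.I_im, mul_one, sub_zero, add_zero] at h1
        exact ⟨abs_le.1 (h1.trans h2), Set.mem_univ _⟩
    _ ≤ _ := by
        rw [Measure.prod_prod, measure_univ, mul_one]
        refine (gaussianReal_Icc_le hv ρ).trans_eq ?_
        rw [Real.coe_toNNReal _ (by positivity)]
        rw [show 2 * Real.pi * (P / 2) = Real.pi * P by ring]

theorem complexGaussian_compl_ball_le {L : ℝ} (hL : 0 < L) :
    complexGaussian 1 {z | L < ‖z‖} ≤ ENNReal.ofReal (1 / L ^ 2) := by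
  have h := mul_meas_ge_le_integral_of_nonneg (Filter.Eventually.of_forall fun z : ℂ => by positivity)
    (integrable_norm_sq_complexGaussian 1) (L ^ 2)
  rw [integral_norm_sq_complexGaussian zero_le_one] at h
  have hsub : (complexGaussian 1).real {z | L < ‖z‖} ≤ 1 / L ^ 2 := by
    rw [le_div_iff₀ (by positivity), mul_comm]
    refine le_trans ?_ h
    refine mul_le_mul_of_nonneg_left (measureReal_mono fun z hz => ?_) (by positivity)
    exact pow_le_pow_left₀ hL.le (le_of_lt hz) 2
  rw [← ofReal_measureReal]
  exact ENNReal.ofReal_le_ofReal hsub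

/-- Stretching by `t⁻¹` multiplies the peak of the density by `t` and only flattens the exponential.
-/
theorem smul_gaussianReal_le_map {v : NNReal} (hv : v ≠ 0) {t : ℝ} (ht : 0 < t) (ht1 : t ≤ 1) :
    ENNReal.ofReal t • gaussianReal 0 v ≤ (gaussianReal 0 v).map (fun x => t⁻¹ * x) := by
  rw [gaussianReal_map_const_mul, mul_zero]
  set v' : NNReal := NNReal.mk (t⁻¹ ^ 2) (sq_nonneg _) * v with hv'
  have hv'c : (v' : ℝ) = t⁻¹ ^ 2 * v := rfl
  have hv'0 : v' ≠ 0 := by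
    have : (0 : ℝ) < v := by positivity
    have h : (0 : ℝ) < v' := by rw [hv'c]; positivity
    exact_mod_cast h.ne'
  rw [gaussianReal_of_var_ne_zero _ hv, gaussianReal_of_var_ne_zero _ hv'0,
    ← withDensity_smul _ (measurable_gaussianPDF 0 v)]
  refine withDensity_mono (Filter.Eventually.of_forall fun x => ?_)
  rw [Pi.smul_apply, smul_eq_mul, gaussianPDF, gaussianPDF, ← ENNReal.ofReal_mul ht.le]
  refine ENNReal.ofReal_le_ofReal ?_
  have hv0 : (0 : ℝ) < v := by positivity
  rw [gaussianPDFReal_def, gaussianPDFReal_def, hv'c]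
  have e1 : (Real.sqrt (2 * Real.pi * (t⁻¹ ^ 2 * v)))⁻¹ = t * (Real.sqrt (2 * Real.pi * v))⁻¹ := by
    rw [show 2 * Real.pi * (t⁻¹ ^ 2 * v) = t⁻¹ ^ 2 * (2 * Real.pi * v) by ring,
      Real.sqrt_mul (by positivity), Real.sqrt_sq (by positivity), mul_inv, inv_inv]
  rw [e1, ← mul_assoc]
  refine mul_le_mul_of_nonneg_left (Real.exp_le_exp.2 ?_) (by positivity)
  rw [neg_div, neg_div, neg_le_neg_iff]
  refine div_le_div_of_nonneg_left (sq_nonneg _) (by positivity) ?_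
  have : 1 ≤ t⁻¹ ^ 2 := one_le_pow₀ ((one_le_inv₀ ht).2 ht1)
  nlinarith

theorem smul_complexGaussian_le_map {t : ℝ} (ht : 0 < t) (ht1 : t ≤ 1) :
    ENNReal.ofReal (t ^ 2) • complexGaussian 1 ≤
      (complexGaussian 1).map (fun z => (t⁻¹ : ℂ) * z) := by
  set γ := gaussianReal 0 ((1 : ℝ) / 2).toNNReal
  have hv : ((1 : ℝ) / 2).toNNReal ≠ 0 := (Real.toNNReal_pos.2 (by positivity)).ne'
  have h := smul_gaussianReal_le_map hv ht ht1
  have hm : Measurable fun x : ℝ => t⁻¹ * x := by fun_prop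
  have h2 := Measure.prod_mono h h
  rw [Measure.map_prod_map γ γ hm hm, Measure.prod_smul_left, Measure.prod_smul_right, smul_smul,
    ← ENNReal.ofReal_mul ht.le, ← sq] at h2
  have h3 := Measure.map_mono h2 measurable_ofReal_add_mul_I
  rw [Measure.map_smul, Measure.map_map measurable_ofReal_add_mul_I (hm.prodMap hm)] at h3
  rw [complexGaussian, Measure.map_map (by fun_prop) measurable_ofReal_add_mul_I]
  refine h3.trans_eq ?_
  congr 1
  funext p
  simp only [Function.comp_apply, Prod.map]
  push_cast
  ring

/-- The product outer measure is the largest one bounded by the product on boxes, so comparing boxes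
suffices. -/
theorem prod_smul_pi_le {ι : Type*} [Fintype ι] {α : ι → Type*} [∀ i, MeasurableSpace (α i)]
    (μ ν : ∀ i, Measure (α i)) [∀ i, SigmaFinite (μ i)] {c : ι → ENNReal}
    (h : ∀ i, c i • μ i ≤ ν i) : (∏ i, c i) • Measure.pi μ ≤ Measure.pi ν := by
  have hle : ((∏ i, c i) • Measure.pi μ).toOuterMeasure ≤
      OuterMeasure.pi fun i => (ν i).toOuterMeasure := by
    refine OuterMeasure.le_pi.2 fun s _ => ?_
    have : ((∏ i, c i) • Measure.pi μ) (Set.univ.pi s) = ∏ i, c i * μ i (s i) := by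
      rw [Measure.smul_apply, Measure.pi_pi, smul_eq_mul, Finset.prod_mul_distrib]
    exact this.trans_le (Finset.prod_le_prod' fun i _ => h i (s i))
  refine Measure.le_iff.2 fun s hs => ?_
  refine (hle s).trans_eq ?_
  rw [Measure.pi, toMeasure_apply _ _ hs]

end Scaling

/-! ### Regrouping of independent variables and change of law. -/

section Independence

variable {Ω α β γ : Type*} [MeasurableSpace Ω] [MeasurableSpace α] [MeasurableSpace β]
  [MeasurableSpace γ] {μ : Measure Ω} [IsProbabilityMeasure μ] {X : Ω → α} {Y : Ω → β} {Z : Ω → γ}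

theorem indepFun_prodMk_left (hX : Measurable X) (hY : Measurable Y) (hZ : Measurable Z)
    (h1 : IndepFun X (fun ω => (Y ω, Z ω)) μ) (h2 : IndepFun Y Z μ) :
    IndepFun (fun ω => (X ω, Y ω)) Z μ := by
  have hXY : IndepFun X Y μ := h1.comp measurable_id measurable_fst
  have e1 := (indepFun_iff_map_prod_eq_prod_map_map hX.aemeasurable
    (hY.prodMk hZ).aemeasurable).1 h1
  have e2 := (indepFun_iff_map_prod_eq_prod_map_map hY.aemeasurable hZ.aemeasurable).1 h2
  have e3 := (indepFun_iff_map_prod_eq_prod_map_map hX.aemeasurable hY.aemeasurable).1 hXY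
  refine (indepFun_iff_map_prod_eq_prod_map_map (hX.prodMk hY).aemeasurable hZ.aemeasurable).2 ?_
  have := Measure.isProbabilityMeasure_map (μ := μ) hX.aemeasurable
  have := Measure.isProbabilityMeasure_map (μ := μ) hY.aemeasurable
  have := Measure.isProbabilityMeasure_map (μ := μ) hZ.aemeasurable
  have e4 : μ.map (fun ω => ((X ω, Y ω), Z ω)) =
      (μ.map (fun ω => (X ω, (Y ω, Z ω)))).map MeasurableEquiv.prodAssoc.symm := by
    rw [Measure.map_map MeasurableEquiv.prodAssoc.symm.measurable (hX.prodMk (hY.prodMk hZ))]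
    rfl
  rw [e4, e1, e2, e3, ← Measure.prodAssoc_prod,
    Measure.map_map MeasurableEquiv.prodAssoc.symm.measurable MeasurableEquiv.prodAssoc.measurable]
  simp

/-- Change of law of the middle one of three independent variables. -/
theorem mul_measure_le_of_smul_map_le (hX : Measurable X) (hY : Measurable Y) (hZ : Measurable Z)
    (h1 : IndepFun X (fun ω => (Y ω, Z ω)) μ) (h2 : IndepFun Y Z μ) {φ : β → β}
    (hφ : Measurable φ) {c : ENNReal} (hc : c • μ.map Y ≤ (μ.map Y).map φ)
    {B : Set (α × β × γ)} (hB : MeasurableSet B) :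
    c * μ {ω | (X ω, Y ω, Z ω) ∈ B} ≤ μ {ω | (X ω, φ (Y ω), Z ω) ∈ B} := by
  have hφY : Measurable fun ω => φ (Y ω) := hφ.comp hY
  have h1' : IndepFun X (fun ω => (φ (Y ω), Z ω)) μ :=
    h1.comp measurable_id (hφ.prodMap measurable_id)
  have h2' : IndepFun (fun ω => φ (Y ω)) Z μ := h2.comp hφ measurable_id
  have e1 := (indepFun_iff_map_prod_eq_prod_map_map hX.aemeasurable
    (hY.prodMk hZ).aemeasurable).1 h1
  have e2 := (indepFun_iff_map_prod_eq_prod_map_map hY.aemeasurable hZ.aemeasurable).1 h2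
  have e1' := (indepFun_iff_map_prod_eq_prod_map_map hX.aemeasurable
    (hφY.prodMk hZ).aemeasurable).1 h1'
  have e2' := (indepFun_iff_map_prod_eq_prod_map_map hφY.aemeasurable hZ.aemeasurable).1 h2'
  have := Measure.isProbabilityMeasure_map (μ := μ) hX.aemeasurable
  have := Measure.isProbabilityMeasure_map (μ := μ) hY.aemeasurable
  have := Measure.isProbabilityMeasure_map (μ := μ) hZ.aemeasurable
  have := Measure.isProbabilityMeasure_map (μ := μ.map Y) hφ.aemeasurable
  have e3 : μ.map (fun ω => φ (Y ω)) = (μ.map Y).map φ := (Measure.map_map hφ hY).symm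
  have hle : c • μ.map (fun ω => (X ω, Y ω, Z ω)) ≤ μ.map (fun ω => (X ω, φ (Y ω), Z ω)) := by
    rw [e1, e1', e2, e2', e3, ← Measure.prod_smul_right, ← Measure.prod_smul_left]
    exact Measure.prod_mono le_rfl (Measure.prod_mono hc le_rfl)
  have h := hle B
  rw [Measure.smul_apply, Measure.map_apply (hX.prodMk (hY.prodMk hZ)) hB,
    Measure.map_apply (hX.prodMk (hφY.prodMk hZ)) hB] at h
  exact h

end Independence

/-! ## The lower bound on the rate -/

theorem RIP.boundedBelowOn {m ι : Type*} [Fintype m] [Fintype ι] [DecidableEq ι]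
    {Θ : Matrix m ι ℂ} {t δ : ℝ} (ht : 0 < t) {k : ℕ} (h : RIP ((t⁻¹ : ℂ) • Θ) k δ)
    {T : Finset ι} (hT : T.card ≤ k) {κ : ℝ} (hκ : κ ≤ t * Real.sqrt (1 - δ)) :
    BoundedBelowOn Θ T κ := by
  intro v hv
  have h1 := (h.of_support hv hT).1
  rw [Matrix.smul_mulVec, euclNorm_smul, norm_inv, Complex.norm_real, Real.norm_of_nonneg ht.le] at h1
  have h2 : Real.sqrt (1 - δ) * euclNorm v ≤ t⁻¹ * euclNorm (Θ *ᵥ v) := by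
    refine abs_le_of_sq_le_sq' ?_ (mul_nonneg (by positivity) (euclNorm_nonneg _)) |>.2
    rwa [mul_pow, Real.sq_sqrt (by linarith [h.2.1])]
  calc κ * euclNorm v ≤ t * Real.sqrt (1 - δ) * euclNorm v :=
        mul_le_mul_of_nonneg_right hκ (euclNorm_nonneg _)
    _ = t * (Real.sqrt (1 - δ) * euclNorm v) := by ring
    _ ≤ t * (t⁻¹ * euclNorm (Θ *ᵥ v)) := by gcongr
    _ = _ := by rw [← mul_assoc, mul_inv_cancel₀ ht.ne', one_mul]

/-- A matrix and a small multiple of it cannot both be almost isometric. -/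
theorem RIP.not_rip_smul {m ι : Type*} [Fintype m] [Fintype ι] [DecidableEq ι]
    {Θ : Matrix m ι ℂ} {t δ : ℝ} (ht : 0 < t) (htδ : t ^ 2 * (1 + δ) < 1 - δ) {k : ℕ} (hk : 1 ≤ k)
    (l : ι) (h : RIP Θ k δ) : ¬ RIP ((t⁻¹ : ℂ) • Θ) k δ := by
  intro h'
  have hsupp : ∀ j ∉ ({l} : Finset ι), (Pi.single l 1 : ι → ℂ) j = 0 := fun j hj =>
    Pi.single_eq_of_ne (by simpa using hj) _
  have h1 := (h.of_support hsupp (by simpa using hk)).1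
  have h2 := (h'.of_support hsupp (by simpa using hk)).2
  have hone : euclNorm (Pi.single l 1 : ι → ℂ) ^ 2 = 1 := by
    rw [euclNorm_sq, Finset.sum_eq_single l]
    · simp
    · intro j _ hj
      simp [hj]
    · simp
  rw [Matrix.smul_mulVec, euclNorm_smul, norm_inv, Complex.norm_real, Real.norm_of_nonneg ht.le,
    mul_pow, inv_pow, hone, inv_mul_le_iff₀ (by positivity)] at h2
  rw [hone] at h1
  linarith

namespace Model

variable {Ω : Type*} [MeasurableSpace Ω] {μ : Measure Ω} {M K Nc R : ℕ}
  {T : Finset (UE K Nc)} {P : ℝ}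

/-- The active symbols are larger than `ρ`, and the noise is at most `L`. -/
def goodEvent (S : Model μ M K Nc R T P) (ρ L : ℝ) : Set Ω :=
  {ω | (∀ l ∈ T, ρ < ‖S.x l ω‖) ∧ ∀ i c, ‖S.n i c ω‖ ≤ L}

/-- The measurement matrix divided by `t` has the restricted isometry property. -/
def ripEvent (S : Model μ M K Nc R T P) (t : ℝ) (k : ℕ) (δ : ℝ) : Set Ω :=
  {ω | RIP ((t⁻¹ : ℂ) • S.measMatrix ω) k δ}

theorem ripEvent_one (S : Model μ M K Nc R T P) (k : ℕ) (δ : ℝ) :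
    S.ripEvent 1 k δ = {ω | RIP (S.measMatrix ω) k δ} := by
  simp [ripEvent]

theorem euclNorm_noise_le (S : Model μ M K Nc R T P) (hM : 0 < M) (hR : 0 < R) (hNc : 0 < Nc)
    {ω : Ω} {lam : ℝ} (hlam : 0 ≤ lam) (hn : ∀ i c, ‖S.n i c ω‖ ≤ lam / (Nc * M)) :
    euclNorm (S.compressionDiag ω *ᵥ fun q => S.n q.2 q.1 ω) ≤ lam := by
  refine abs_le_of_sq_le_sq' ?_ hlam |>.2
  refine (euclNorm_mulVec_sq_le _ _).trans ?_
  rw [S.sum_norm_compressionDiag_sq ω hM hR, euclNorm_sq]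
  have hM1 : (1 : ℝ) ≤ M := by exact_mod_cast hM
  have hN0 : (0 : ℝ) < Nc := by exact_mod_cast hNc
  calc (Nc : ℝ) * ∑ q : Fin Nc × Fin M, ‖S.n q.2 q.1 ω‖ ^ 2
      ≤ Nc * ∑ _q : Fin Nc × Fin M, (lam / (Nc * M)) ^ 2 := by
        gcongr with q
        exact hn q.2 q.1
    _ = lam ^ 2 / M := by
        simp
        field_simp
    _ ≤ lam ^ 2 := div_le_self (sq_nonneg _) hM1

/-- Applied with `τ = 1` and `τ = t`. The common lower bound `t √(1 - δ)` of `Θ` on `T` gives the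
same rate at both scales. -/
theorem le_sumRate_of_mem_goodEvent (S : Model μ M K Nc R T P) (hM : 0 < M) (hR : 0 < R)
    (hNc : 0 < Nc) (hP : 0 ≤ P) (hT : 0 < T.card) {δ t τ lam ρ : ℝ} (ht : 0 < t) (hτ : t ≤ τ)
    (hδ0 : 0 ≤ δ) (hδ1 : δ < 1) (hδ : (1 + Real.sqrt 2) * δ < 1) (hlam : 0 ≤ lam)
    (hρ1 : c₂ δ * (lam / t) ≤ ρ) (hρ2 : 2 * lam ≤ t * Real.sqrt (1 - δ) * ρ) {ω : Ω}
    (hx : ∀ l ∉ T, S.x l ω = 0) (hrip : ω ∈ S.ripEvent τ (2 * T.card) δ)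
    (hgood : ω ∈ S.goodEvent ρ (lam / (Nc * M))) {That : Finset (UE K Nc)}
    (hdet : IsDetected (S.measMatrix ω) (S.observed ω) lam That) :
    T.card * Real.log (1 + P / (Nc / (t ^ 2 * (1 - δ)))) ≤
      sumRate (S.measMatrix ω) (S.compressionDiag ω) P T That := by
  have hτ0 : 0 < τ := ht.trans_le hτ
  have hsq : 0 < Real.sqrt (1 - δ) := Real.sqrt_pos.2 (by linarith)
  have hκ : 0 < t * Real.sqrt (1 - δ) := by positivity
  have hlow : BoundedBelowOn (S.measMatrix ω) T (t * Real.sqrt (1 - δ)) :=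
    RIP.boundedBelowOn hτ0 hrip (by omega) (by gcongr)
  have hc₂ : 0 ≤ c₂ δ := by
    have : 0 < 1 - (1 + Real.sqrt 2) * δ := by linarith
    unfold c₂
    positivity
  rw [S.observed_eq] at hdet
  have hThat : That = T := by
    refine IsDetected.eq_of_rip hτ0 hrip hδ hT hx
      (S.euclNorm_noise_le hM hR hNc hlam hgood.2) hκ hlow (fun l hl => ?_) (fun l hl => ?_) hdet
    · refine lt_of_le_of_lt (le_trans ?_ hρ1) (hgood.1 l hl)
      gcongr
    · refine hρ2.trans_lt ?_
      have := hgood.1 l hl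
      gcongr
  rw [hThat]
  have h := S.le_sumRate_self hM hR hNc hP ω hκ hlow
  rwa [mul_pow, Real.sq_sqrt (by linarith)] at h

theorem measurableSet_ripEvent (S : Model μ M K Nc R T P) (t : ℝ) (k : ℕ) (δ : ℝ) :
    MeasurableSet (S.ripEvent t k δ) := by
  refine measurableSet_rip (fun p l => ?_) k δ
  simp only [Matrix.smul_apply, smul_eq_mul]
  exact (S.measurable_measMatrix p l).const_mul _

theorem measurableSet_good (T : Finset (UE K Nc)) (ρ L : ℝ) :
    MeasurableSet {y : (UE K Nc → ℂ) × (Fin M → Fin Nc → ℂ) |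
      (∀ l ∈ T, ρ < ‖y.1 l‖) ∧ ∀ i c, ‖y.2 i c‖ ≤ L} := by
  have h : {y : (UE K Nc → ℂ) × (Fin M → Fin Nc → ℂ) |
      (∀ l ∈ T, ρ < ‖y.1 l‖) ∧ ∀ i c, ‖y.2 i c‖ ≤ L} =
        (⋂ l ∈ T, {y | ρ < ‖y.1 l‖}) ∩ ⋂ i, ⋂ c, {y | ‖y.2 i c‖ ≤ L} := by
    ext y
    simp only [Set.mem_inter_iff, Set.mem_iInter, Set.mem_ofPred_eq]
  rw [h]
  refine MeasurableSet.inter ?_ ?_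
  · exact MeasurableSet.iInter fun l => MeasurableSet.iInter fun _ =>
      measurableSet_lt measurable_const (by fun_prop)
  · exact MeasurableSet.iInter fun i => MeasurableSet.iInter fun c =>
      measurableSet_le (by fun_prop) measurable_const

theorem measurableSet_goodEvent (S : Model μ M K Nc R T P) (ρ L : ℝ) :
    MeasurableSet (S.goodEvent ρ L) :=
  (S.measurable_symbols.prodMk S.measurable_noise) (measurableSet_good T ρ L)

/-- The first event depends on fading and phases only, the second on symbols and noise only. -/
theorem measure_ripEvent_inter_goodEvent [IsProbabilityMeasure μ] (S : Model μ M K Nc R T P)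
    (t : ℝ) (k : ℕ) (δ ρ L : ℝ) : μ (S.ripEvent t k δ ∩ S.goodEvent ρ L) =
      μ (S.ripEvent t k δ) * μ (S.goodEvent ρ L) := by
  have h1 := indepFun_prodMk_left S.measurable_fading S.measurable_smallFading
    (S.measurable_phases.prodMk (S.measurable_symbols.prodMk S.measurable_noise)) S.indep_g S.indep_h
  have h2 := indepFun_prodMk_left (S.measurable_fading.prodMk S.measurable_smallFading)
    S.measurable_phases (S.measurable_symbols.prodMk S.measurable_noise) h1 S.indep_θ
  have hA : MeasurableSet {w : ((Fin M → UE K Nc → ℝ) × (Fin M → UE K Nc → ℂ)) ×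
      (Fin M → Fin R → Fin Nc → ℝ) | RIP ((t⁻¹ : ℂ) • fadingMatrix w.1.1 w.1.2 w.2) k δ} := by
    refine measurableSet_rip (fun p l => ?_) k δ
    simp only [Matrix.smul_apply, smul_eq_mul]
    refine Measurable.const_mul ?_ _
    unfold fadingMatrix phaseMatrix
    simp only [Matrix.of_apply]
    fun_prop
  have h3 := h2.measure_inter_preimage_eq_mul _ _ hA (measurableSet_good T ρ L)
  have e : S.ripEvent t k δ = {ω | RIP ((t⁻¹ : ℂ) • fadingMatrix (fun i l => S.g i l ω)
      (fun i l => S.h i l ω) (fun i r c => S.θ i r c ω)) k δ} := by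
    simp only [ripEvent, measMatrix_eq]
  rw [e]
  exact h3

/-- Scaling of the Gaussian small scale fading changes probabilities by a bounded factor. -/
theorem mul_measure_le_scaled [IsProbabilityMeasure μ] (S : Model μ M K Nc R T P) {t : ℝ}
    (ht : 0 < t) (ht1 : t ≤ 1) (k : ℕ) (δ ρ L : ℝ) :
    ENNReal.ofReal (t ^ 2) ^ (M * (Nc * K)) * μ (S.ripEvent 1 k δ ∩ S.goodEvent ρ L) ≤
      μ (S.ripEvent t k δ ∩ S.goodEvent ρ L) := by
  let flat : (Fin M → UE K Nc → ℂ) → Fin M × UE K Nc → ℂ := fun h p => h p.1 p.2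
  have hflat : Measurable flat := by fun_prop
  let φ : (Fin M × UE K Nc → ℂ) → Fin M × UE K Nc → ℂ := fun H p => (t⁻¹ : ℂ) * H p
  have hφ : Measurable φ := by fun_prop
  have hY : Measurable fun ω => flat fun i l => S.h i l ω := hflat.comp S.measurable_smallFading
  have hlaw : μ.map (fun ω => flat fun i l => S.h i l ω) =
      Measure.pi fun _ => complexGaussian 1 := by
    have := (iIndepFun_iff_map_fun_eq_pi_map fun p : Fin M × UE K Nc =>
      (S.measurable_h p.1 p.2).aemeasurable).1 S.h_indep
    refine this.trans ?_
    congr 1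
    funext p
    exact S.h_law _ _
  -- Each of the `M * (Nc * K)` complex coefficients costs `t²`: one `t` for each real dimension.
  have hc : ENNReal.ofReal (t ^ 2) ^ (M * (Nc * K)) •
      μ.map (fun ω => flat fun i l => S.h i l ω) ≤
        (μ.map (fun ω => flat fun i l => S.h i l ω)).map φ := by
    have hm : Measurable fun z : ℂ => (t⁻¹ : ℂ) * z := by fun_prop
    have := Measure.isProbabilityMeasure_map (μ := complexGaussian 1) hm.aemeasurable
    have h := prod_smul_pi_le (fun _ : Fin M × UE K Nc => complexGaussian 1)
      (fun _ => (complexGaussian 1).map fun z => (t⁻¹ : ℂ) * z)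
      (c := fun _ => ENNReal.ofReal (t ^ 2)) fun _ => smul_complexGaussian_le_map ht ht1
    rw [Finset.prod_const, Finset.card_univ, ← Measure.pi_map_pi fun _ => hm.aemeasurable] at h
    rw [hlaw]
    simpa using h
  have hB : MeasurableSet {w : (Fin M → UE K Nc → ℝ) × (Fin M × UE K Nc → ℂ) ×
      (Fin M → Fin R → Fin Nc → ℝ) × (UE K Nc → ℂ) × (Fin M → Fin Nc → ℂ) |
        RIP (fadingMatrix w.1 (fun i l => w.2.1 (i, l)) w.2.2.1) k δ ∧
          w.2.2.2 ∈ {y : (UE K Nc → ℂ) × (Fin M → Fin Nc → ℂ) |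
            (∀ l ∈ T, ρ < ‖y.1 l‖) ∧ ∀ i c, ‖y.2 i c‖ ≤ L}} := by
    refine MeasurableSet.inter (measurableSet_rip (fun p l => ?_) k δ)
      ((measurable_snd.comp (measurable_snd.comp measurable_snd)) (measurableSet_good T ρ L))
    unfold fadingMatrix phaseMatrix
    simp only [Matrix.of_apply]
    fun_prop
  have h := mul_measure_le_of_smul_map_le S.measurable_fading hY
    (S.measurable_phases.prodMk (S.measurable_symbols.prodMk S.measurable_noise))
    (S.indep_g.comp measurable_id (hflat.prodMap measurable_id))
    (S.indep_h.comp hflat measurable_id) hφ hc hB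
  have e1 : S.ripEvent 1 k δ ∩ S.goodEvent ρ L = {ω | RIP (fadingMatrix (fun i l => S.g i l ω)
      (fun i l => S.h i l ω) (fun i r c => S.θ i r c ω)) k δ ∧
        ω ∈ S.goodEvent ρ L} := by
    rw [ripEvent_one]
    ext ω
    simp only [measMatrix_eq]
    rfl
  have e2 : S.ripEvent t k δ ∩ S.goodEvent ρ L = {ω | RIP (fadingMatrix (fun i l => S.g i l ω)
      ((t⁻¹ : ℂ) • fun i l => S.h i l ω) (fun i r c => S.θ i r c ω)) k δ ∧
        ω ∈ S.goodEvent ρ L} := by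
    ext ω
    simp only [ripEvent, measMatrix_eq, fadingMatrix_smul]
    rfl
  rw [e1, e2]
  exact h

theorem one_sub_le_measureReal_goodEvent [IsProbabilityMeasure μ] (S : Model μ M K Nc R T P)
    (hP : 0 < P) {ρ L : ℝ} (hρ : 0 ≤ ρ) (hL : 0 < L) :
    1 - T.card * (2 * ρ / Real.sqrt (Real.pi * P)) - M * Nc * (1 / L ^ 2) ≤
      μ.real (S.goodEvent ρ L) := by
  have hx : ∀ l ∈ T, μ.real {ω | ‖S.x l ω‖ ≤ ρ} ≤ 2 * ρ / Real.sqrt (Real.pi * P) := by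
    intro l hl
    refine ENNReal.toReal_le_of_le_ofReal (by positivity) ?_
    have h := complexGaussian_ball_le hP ρ
    rwa [← S.x_active l hl, Measure.map_apply (S.measurable_x l)
      (measurableSet_le measurable_norm measurable_const)] at h
  have hn : ∀ i c, μ.real {ω | L < ‖S.n i c ω‖} ≤ 1 / L ^ 2 := by
    intro i c
    refine ENNReal.toReal_le_of_le_ofReal (by positivity) ?_
    have h := complexGaussian_compl_ball_le hL
    rwa [← S.n_law i c, Measure.map_apply (S.measurable_n i c)
      (measurableSet_lt measurable_const measurable_norm)] at h
  have hsub : (S.goodEvent ρ L)ᶜ ⊆ (⋃ l ∈ T, {ω | ‖S.x l ω‖ ≤ ρ}) ∪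
      ⋃ p ∈ (Finset.univ : Finset (Fin M × Fin Nc)), {ω | L < ‖S.n p.1 p.2 ω‖} := by
    intro ω hω
    simp only [Set.mem_union, Set.mem_iUnion, Set.mem_ofPred_eq, Finset.mem_univ, exists_prop,
      true_and, Prod.exists]
    by_contra! hc
    exact hω ⟨fun l hl => hc.1 l.1 l.2 hl, hc.2⟩
  have hcompl : μ.real (S.goodEvent ρ L)ᶜ ≤
      T.card * (2 * ρ / Real.sqrt (Real.pi * P)) + M * Nc * (1 / L ^ 2) := by
    refine (measureReal_mono hsub).trans ((measureReal_union_le _ _).trans (add_le_add ?_ ?_))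
    · refine (measureReal_biUnion_finset_le _ _).trans ?_
      calc _ ≤ ∑ l ∈ T, 2 * ρ / Real.sqrt (Real.pi * P) := Finset.sum_le_sum hx
        _ = _ := by simp
    · refine (measureReal_biUnion_finset_le _ _).trans ?_
      calc _ ≤ ∑ p : Fin M × Fin Nc, 1 / L ^ 2 := Finset.sum_le_sum fun p _ => hn p.1 p.2
        _ = _ := by simp
  rw [probReal_compl_eq_one_sub (S.measurableSet_goodEvent ρ L)] at hcompl
  linarith

/-- The isometry events at scales `1` and `t` are disjoint, and each yields the same rate on the
good event, so their probabilities add; the second contributes the extra factor. -/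
theorem le_integral_sumRate [IsProbabilityMeasure μ] (S : Model μ M K Nc R T P) (hM : 0 < M)
    (hR : 0 < R) (hNc : 0 < Nc) (hP : 0 ≤ P) (hT : 0 < T.card) {δ t lam ρ : ℝ} (ht : 0 < t)
    (ht1 : t ≤ 1) (htδ : t ^ 2 * (1 + δ) < 1 - δ)
    (hδ0 : 0 ≤ δ) (hδ1 : δ < 1) (hδ : (1 + Real.sqrt 2) * δ < 1) (hlam : 0 ≤ lam)
    (hρ1 : c₂ δ * (lam / t) ≤ ρ) (hρ2 : 2 * lam ≤ t * Real.sqrt (1 - δ) * ρ)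
    {That : Ω → Finset (UE K Nc)} (hm : Measurable That)
    (hdet : ∀ᵐ ω ∂μ, IsDetected (S.measMatrix ω) (S.observed ω) lam (That ω)) :
    (1 + (t ^ 2) ^ (M * (Nc * K))) * μ.real (S.ripEvent 1 (2 * T.card) δ) *
        μ.real (S.goodEvent ρ (lam / (Nc * M))) *
          (T.card * Real.log (1 + P / (Nc / (t ^ 2 * (1 - δ))))) ≤
      ∫ ω, sumRate (S.measMatrix ω) (S.compressionDiag ω) P T (That ω) ∂μ := by
  set G := S.goodEvent ρ (lam / (Nc * M))
  set E := S.ripEvent 1 (2 * T.card) δ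
  set N := S.ripEvent t (2 * T.card) δ
  set r : ℝ := T.card * Real.log (1 + P / (Nc / (t ^ 2 * (1 - δ)))) with hr
  have hδ' : 0 < 1 - δ := by linarith
  have hr0 : 0 ≤ r :=
    mul_nonneg (Nat.cast_nonneg _) (Real.log_nonneg (le_add_of_nonneg_right (by positivity)))
  have hEm : MeasurableSet (E ∩ G) :=
    (S.measurableSet_ripEvent _ _ _).inter (S.measurableSet_goodEvent _ _)
  have hNm : MeasurableSet (N ∩ G) :=
    (S.measurableSet_ripEvent _ _ _).inter (S.measurableSet_goodEvent _ _)
  have hdisj : Disjoint (E ∩ G) (N ∩ G) := by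
    obtain ⟨l, -⟩ := Finset.card_pos.1 hT
    refine Set.disjoint_left.2 fun ω h1 h2 => ?_
    have h1' : RIP (S.measMatrix ω) (2 * T.card) δ := by
      have : ω ∈ {ω | RIP (S.measMatrix ω) (2 * T.card) δ} := by
        rw [← ripEvent_one]; exact h1.1
      exact this
    exact h1'.not_rip_smul ht htδ (by omega) l h2.1
  have hE : μ.real (E ∩ G) = μ.real E * μ.real G := by
    simp only [measureReal_def, E, G, S.measure_ripEvent_inter_goodEvent, ENNReal.toReal_mul]
  have hN : (t ^ 2) ^ (M * (Nc * K)) * μ.real (E ∩ G) ≤ μ.real (N ∩ G) := by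
    have h := ENNReal.toReal_mono (measure_ne_top _ _)
      (S.mul_measure_le_scaled ht ht1 (2 * T.card) δ ρ (lam / (Nc * M)))
    rwa [ENNReal.toReal_mul, ENNReal.toReal_pow, ENNReal.toReal_ofReal (by positivity)] at h
  have hprob : (1 + (t ^ 2) ^ (M * (Nc * K))) * μ.real E * μ.real G ≤
      μ.real ((E ∩ G) ∪ (N ∩ G)) := by
    rw [measureReal_union hdisj hNm]
    rw [hE] at hN ⊢
    linarith
  have hx : ∀ᵐ ω ∂μ, ∀ l ∉ T, S.x l ω = 0 := by
    rw [ae_all_iff]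
    intro l
    by_cases hl : l ∈ T
    · simp [hl]
    · filter_upwards [S.x_inactive l hl] with ω hω _ using hω
  calc _ ≤ μ.real ((E ∩ G) ∪ (N ∩ G)) * r := by gcongr
    _ = ∫ ω, ((E ∩ G) ∪ (N ∩ G)).indicator (fun _ => r) ω ∂μ := by
        rw [integral_indicator_const _ (hEm.union hNm), smul_eq_mul]
    _ ≤ _ := by
        refine integral_mono_ae ((integrable_const r).indicator (hEm.union hNm))
          (S.integrable_sumRate hP hm) ?_
        filter_upwards [hx, hdet] with ω hxω hω
        refine Set.indicator_apply_le' (fun hmem => ?_) (fun _ => sumRate_nonneg _ _ hP _ _)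
        rcases hmem with h | h
        · exact S.le_sumRate_of_mem_goodEvent hM hR hNc hP hT ht ht1 hδ0 hδ1 hδ hlam hρ1 hρ2
            hxω h.1 h.2 hω
        · exact S.le_sumRate_of_mem_goodEvent hM hR hNc hP hT ht le_rfl hδ0 hδ1 hδ hlam hρ1 hρ2
            hxω h.1 h.2 hω

end Model

open Filter Topology in
/-- At high SNR the factor `1 + c` outweighs the loss in the rate and in probability. -/
theorem eventually_log_le {a b c C C0 C1 : ℝ} (ha : 0 < a) (hb : 0 < b) (hc : 0 < c) (hC0 : 0 < C0)
    (hC1 : 0 ≤ C1) (s q : ℝ) :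
    ∀ᶠ P : ℝ in atTop, Real.log (1 + C1 * P) ≤
      (1 + c) * (1 - s * (2 * (C * (a * P) ^ (1 / 4 : ℝ)) / Real.sqrt (Real.pi * P)) -
        q * (1 / ((a * P) ^ (1 / 4 : ℝ) / b) ^ 2)) * Real.log (1 + P / C0) := by
  have hroot : Tendsto (fun P : ℝ => (a * P) ^ (1 / 4 : ℝ)) atTop atTop :=
    (tendsto_rpow_atTop (by norm_num)).comp (tendsto_id.const_mul_atTop ha)
  have h1 : Tendsto (fun P : ℝ => 2 * (C * (a * P) ^ (1 / 4 : ℝ)) / Real.sqrt (Real.pi * P))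
      atTop (𝓝 0) := by
    have h : Tendsto (fun P : ℝ => 2 * C * a ^ (1 / 4 : ℝ) / Real.sqrt Real.pi *
        P ^ (-(1 / 4) : ℝ)) atTop (𝓝 0) := by
      simpa using (tendsto_rpow_neg_atTop (show (0 : ℝ) < 1 / 4 by norm_num)).const_mul
        (2 * C * a ^ (1 / 4 : ℝ) / Real.sqrt Real.pi)
    refine h.congr' ?_
    filter_upwards [eventually_gt_atTop 0] with P hP
    -- The symbol threshold grows like `P^(1/4)` against a symbol size of `√P`.
    have e : P ^ (-(1 / 4) : ℝ) = P ^ (1 / 4 : ℝ) / Real.sqrt P := by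
      rw [Real.sqrt_eq_rpow, ← Real.rpow_sub hP]
      norm_num
    rw [Real.mul_rpow ha.le hP.le, Real.sqrt_mul Real.pi_pos.le, e]
    field_simp
  have h2 : Tendsto (fun P : ℝ => 1 / ((a * P) ^ (1 / 4 : ℝ) / b) ^ 2) atTop (𝓝 0) := by
    refine ((tendsto_pow_atTop two_ne_zero).comp
      (hroot.atTop_div_const hb)).inv_tendsto_atTop.congr fun P => ?_
    simp
  have h3 : Tendsto (fun P : ℝ => (1 + c) * (1 - s * (2 * (C * (a * P) ^ (1 / 4 : ℝ)) /
      Real.sqrt (Real.pi * P)) - q * (1 / ((a * P) ^ (1 / 4 : ℝ) / b) ^ 2))) atTop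
        (𝓝 (1 + c)) := by
    simpa using (((tendsto_const_nhds (x := (1 : ℝ))).sub (h1.const_mul s)).sub (h2.const_mul q)).const_mul (1 + c)
  have h4 : Tendsto (fun P : ℝ => c / 2 * Real.log P) atTop atTop :=
    Real.tendsto_log_atTop.const_mul_atTop (by positivity)
  -- Half of the gain `c` absorbs the probability loss; the other half, times `log P`, absorbs the
  -- constants `C0` and `C1`.
  filter_upwards [h3.eventually_const_lt (show 1 + c / 2 < 1 + c by linarith),
    h4.eventually_ge_atTop ((1 + c / 2) * Real.log C0 + Real.log (1 + C1)),
    eventually_ge_atTop 1] with P hP1 hP2 hP3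
  have hP0 : 0 < P := by linarith
  have e1 : Real.log (1 + C1 * P) ≤ Real.log (1 + C1) + Real.log P := by
    rw [← Real.log_mul (by positivity) hP0.ne']
    exact Real.log_le_log (by positivity) (by nlinarith)
  have e2 : Real.log P - Real.log C0 ≤ Real.log (1 + P / C0) := by
    rw [← Real.log_div hP0.ne' hC0.ne']
    exact Real.log_le_log (by positivity) (by linarith)
  have e3 : 0 ≤ Real.log (1 + P / C0) :=
    Real.log_nonneg (le_add_of_nonneg_right (by positivity))
  calc _ ≤ (1 + c / 2) * (Real.log P - Real.log C0) := by linarith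
    _ ≤ (1 + c / 2) * Real.log (1 + P / C0) := by gcongr
    _ ≤ _ := mul_le_mul_of_nonneg_right hP1.le e3

end CRAN

/-! ### Assembly of the two bounds. -/

theorem theorem4 (M K Nc R s : ℕ) (hM : 0 < M) (hK : 0 < K) (hR : 0 < R) (hRN : R ≤ Nc) :
    -- upper bound
    (∀ {Ω : Type*} [MeasurableSpace Ω] (μ : Measure Ω) [IsProbabilityMeasure μ]
      (T : Finset (CRAN.UE K Nc)) (_ : T.card = s) (P : ℝ) (_ : 0 < P)
      (S : CRAN.Model μ M K Nc R T P) (lam : ℝ) (That : Ω → Finset (CRAN.UE K Nc))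
      (_ : Measurable That)
      (_ : ∀ᵐ ω ∂μ, CRAN.IsDetected (S.measMatrix ω) (S.observed ω) lam (That ω)),
      Integrable
        (fun ω => CRAN.sumRate (S.measMatrix ω) (S.compressionDiag ω) P T (That ω)) μ ∧
      ∫ ω, CRAN.sumRate (S.measMatrix ω) (S.compressionDiag ω) P T (That ω) ∂μ ≤
        s * Real.log (1 + M * ((R : ℝ) / Nc) * P)) ∧
    -- lower bound at high SNR
    (∀ δ : ℝ, 0 ≤ δ → δ < Real.sqrt 2 - 1 → ∃ κ : ℝ, 0 < κ ∧
      ∀ {Ω : Type*} [MeasurableSpace Ω] (μ : Measure Ω) [IsProbabilityMeasure μ]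
        (T : Finset (CRAN.UE K Nc)) (_ : T.card = s) (P : ℝ)
        (_ : κ * (4 * CRAN.c₂ δ ^ 2 * Nc) ≤ P)
        (S : CRAN.Model μ M K Nc R T P) (That : Ω → Finset (CRAN.UE K Nc))
        (_ : Measurable That)
        (_ : ∀ᵐ ω ∂μ, CRAN.IsDetected (S.measMatrix ω) (S.observed ω)
          ((P * Nc / (4 * CRAN.c₂ δ ^ 2)) ^ (1 / 4 : ℝ)) (That ω)),
        μ.real {ω | CRAN.RIP (S.measMatrix ω) (2 * s) δ} *
            (s * Real.log (1 + (1 - δ) * M * ((R : ℝ) / Nc) * P)) ≤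
          ∫ ω, CRAN.sumRate (S.measMatrix ω) (S.compressionDiag ω) P T (That ω) ∂μ) := by
  have hNc : 0 < Nc := hR.trans_le hRN
  refine ⟨fun μ _ T hT P hP S lam That hm _ => ?_, fun δ hδ0 hδs => ?_⟩
  · subst hT
    exact ⟨S.integrable_sumRate hP.le hm, S.integral_sumRate_le hP.le hm⟩
  have hsq2 : Real.sqrt 2 ^ 2 = 2 := Real.sq_sqrt (by norm_num)
  have hsq2n := Real.sqrt_nonneg 2
  have hδ1 : δ < 1 := by nlinarith
  have hδ : (1 + Real.sqrt 2) * δ < 1 := by nlinarith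
  have hδ' : 0 < 1 - δ := by linarith
  have hN0 : (0 : ℝ) < Nc := by exact_mod_cast hNc
  have hM0 : (0 : ℝ) < M := by exact_mod_cast hM
  have hR0 : (0 : ℝ) < R := by exact_mod_cast hR
  have hc₂ : 0 < CRAN.c₂ δ := by
    have : 0 < 1 - (1 + Real.sqrt 2) * δ := by linarith
    unfold CRAN.c₂
    positivity
  -- This inequality makes the isometry events at scales `1` and `t` disjoint. The chosen `t` gives
  -- `t² (1 + δ) = (1 - δ) / 2`.
  obtain ⟨t, ht, ht1, htδ⟩ : ∃ t : ℝ, 0 < t ∧ t ≤ 1 ∧ t ^ 2 * (1 + δ) < 1 - δ := by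
    have hq : 0 < (1 - δ) / (2 * (1 + δ)) := by positivity
    refine ⟨Real.sqrt ((1 - δ) / (2 * (1 + δ))), Real.sqrt_pos.2 hq, ?_, ?_⟩
    · rw [Real.sqrt_le_one, div_le_one (by positivity)]
      linarith
    · rw [Real.sq_sqrt hq.le, div_mul_eq_mul_div, div_lt_iff₀ (by positivity)]
      nlinarith
  have hsq : 0 < Real.sqrt (1 - δ) := Real.sqrt_pos.2 hδ'
  -- `C` adds the two requirements on `ρ / lam`: `c₂ δ / t` for separating the users after basis
  -- pursuit, and `2 / (t √(1 - δ))` for the residual test.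
  have hev := CRAN.eventually_log_le (a := Nc / (4 * CRAN.c₂ δ ^ 2)) (b := Nc * M)
    (c := (t ^ 2) ^ (M * (Nc * K))) (C := CRAN.c₂ δ / t + 2 / (t * Real.sqrt (1 - δ)))
    (C0 := Nc / (t ^ 2 * (1 - δ))) (C1 := (1 - δ) * M * ((R : ℝ) / Nc)) (by positivity)
    (by positivity) (by positivity) (by positivity) (by positivity) s (M * Nc)
  obtain ⟨P₀, hP₀⟩ := Filter.eventually_atTop.1 hev
  have hden : 0 < 4 * CRAN.c₂ δ ^ 2 * Nc := by positivity
  -- `P₀` is fixed before the probability space, so the constant is uniform over models; the maximum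
  -- with 1 forces `P > 0`.
  refine ⟨max P₀ 1 / (4 * CRAN.c₂ δ ^ 2 * Nc), by positivity,
    fun μ _ T hT P hP S That hm hdet => ?_⟩
  rw [div_mul_cancel₀ _ hden.ne'] at hP
  have hP0 : 0 < P := zero_lt_one.trans_le ((le_max_right _ _).trans hP)
  have hlog := hP₀ P ((le_max_left _ _).trans hP)
  rw [show Nc / (4 * CRAN.c₂ δ ^ 2) * P = P * Nc / (4 * CRAN.c₂ δ ^ 2) by ring] at hlog
  subst hT
  -- With no active user the isometry property of order 0 is vacuous and the two scales are not
  -- disjoint, but then the bound is 0.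
  rcases Nat.eq_zero_or_pos T.card with hs | hs
  · rw [hs, Nat.cast_zero, zero_mul, mul_zero]
    exact integral_nonneg fun ω => CRAN.sumRate_nonneg _ _ hP0.le _ _
  set lam := (P * Nc / (4 * CRAN.c₂ δ ^ 2)) ^ (1 / 4 : ℝ) with hlam
  have hlam0 : 0 < lam := by positivity
  set ρ := (CRAN.c₂ δ / t + 2 / (t * Real.sqrt (1 - δ))) * lam with hρ
  have hρ1 : CRAN.c₂ δ * (lam / t) ≤ ρ := by
    have : 0 ≤ 2 / (t * Real.sqrt (1 - δ)) * lam := by positivity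
    calc CRAN.c₂ δ * (lam / t) = CRAN.c₂ δ / t * lam := by ring
      _ ≤ ρ := by rw [hρ, add_mul]; linarith
  have hρ2 : 2 * lam ≤ t * Real.sqrt (1 - δ) * ρ := by
    have : 0 ≤ t * Real.sqrt (1 - δ) * (CRAN.c₂ δ / t * lam) := by positivity
    calc 2 * lam = t * Real.sqrt (1 - δ) * (2 / (t * Real.sqrt (1 - δ)) * lam) := by field_simp
      _ ≤ _ := by rw [hρ, add_mul, mul_add]; linarith
  have hmain := S.le_integral_sumRate hM hR hNc hP0.le hs ht ht1 htδ hδ0 hδ1 hδ hlam0.le hρ1 hρ2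
    hm hdet
  have hgood := S.one_sub_le_measureReal_goodEvent hP0 (ρ := ρ) (L := lam / (Nc * M))
    (by positivity) (by positivity)
  rw [S.ripEvent_one] at hmain
  refine le_trans ?_ hmain
  set r := Real.log (1 + P / (Nc / (t ^ 2 * (1 - δ))))
  have hr : 0 ≤ r := Real.log_nonneg (le_add_of_nonneg_right (by positivity))
  have hstep : Real.log (1 + (1 - δ) * M * ((R : ℝ) / Nc) * P) ≤
      (1 + (t ^ 2) ^ (M * (Nc * K))) * μ.real (S.goodEvent ρ (lam / (Nc * M))) * r :=
    hlog.trans (by gcongr)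
  calc _ ≤ μ.real {ω | CRAN.RIP (S.measMatrix ω) (2 * T.card) δ} * (T.card *
        ((1 + (t ^ 2) ^ (M * (Nc * K))) * μ.real (S.goodEvent ρ (lam / (Nc * M))) * r)) := by
        gcongr
    _ = _ := by ring
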